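/- Let ${\cal D}=\langle\Psi,\Sigma,Q,\eta,q_0,L\rangle$ be a finite transducer with a partial transition function $\eta:Q\times\Psi\rightharpoonup Q$ and an output labelling $L:Q\to\Sigma$. Let $B=\langle\Upsilon\times\Sigma,S,\delta,s_0,F\rangle$ be a finite deterministic Büchi word automaton with a partial transition function $\delta:S\times(\Upsilon\times\Sigma)\rightharpoonup S$ and set of Büchi states $F$. Let $\upsilon_0\in\Upsilon$ be the direction of the root, let $q^\bot\notin Q$, and put $Q^\bot=Q\cup\{q^\bot\}$. A (memoryless) *combined weight-ranking* for $B$ and ${\cal D}$ with branching $\Upsilon$ consists of functions $w:(Q\times S)\cup(Q\times S\times\Psi\times\Upsilon)\to\mathbb N$ and $d:Q^\bot\times S\to\mathbb N\cup\{\infty\}$ such that the following holds. 1. $\delta(s_0,(\upsilon_0,L(q_0)))$ is defined, $w(q_0,\delta(s_0,(\upsilon_0,L(q_0))))=1$ and $d(q_0,\delta(s_0,(\upsilon_0,L(q_0))))\neq\infty$. 2. For all $q,s,\psi,\upsilon$: if $w(q,s,\psi,\upsilon)>0$, then $\eta(q,\psi)$ and $\delta(s,(\upsilon,L(\eta(q,\psi))))$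 are defined. Whenever both are defined, $w(q,s,\psi,\upsilon)\ge w(\eta(q,\psi),\delta(s,(\upsilon,L(\eta(q,\psi)))))$. 3. For all $q,s$: $\sum_{\psi,\upsilon}w(q,s,\psi,\upsilon)\le|\Upsilon|\cdot w(q,s)$; and $\sum_{\psi}w(q,s,\psi,\upsilon)\le w(q,s)$ for every $\upsilon$. 4. For all $q\in Q$, $s\notin F$ and $\upsilon$ with $d(q,s)\ne\infty$: $d(q,s)>d(\eta(q,\psi),\delta(s,(\upsilon,L(\eta(q,\psi)))))$ for every $\psi$ with $w(q,s,\psi,\upsilon)>0$; and if $\sum_\psi w(q,s,\psi,\upsilon)<w(q,s)$, then there is $\sigma\in\Sigma$ such that $\delta(s,(\upsilon,\sigma))$ is defined and $d(q,s)>d(q^\bot,\delta(s,(\upsilon,\sigma)))$. For all $q\in Q$, $s\in F$ and $\upsilon$ with $d(q,s)\neq\infty$ the same holds with "$d(q,s)>\cdots$" replaced by "$\cdots\ne\infty$". 5. For all $s$ with $d(q^\bot,s)\ne\infty$ and all $\upsilon$ there is $\sigma\in\Sigma$ such that $\delta(s,(\upsilon,\sigma))$ is defined and $d(q^\bot,\delta(s,(\upsilon,\sigma)))$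 is smaller than $d(q^\bot,s)$ if $s\notin F$, and is not $\infty$ if $s\in F$. A pair $(q,s)$ is *reachable* if it is obtained from $(q_0,\delta(s_0,(\upsilon_0,L(q_0))))$ by finitely many joint transitions $(q,s)\mapsto(\eta(q,\psi),\delta(s,(\upsilon,L(\eta(q,\psi)))))$. **Corollary.** Let $(w,d)$ be a memoryless combined weight-ranking for $B$ and ${\cal D}$ with branching $\Upsilon$. Then all weights at reachable pairs are bounded by $|\Upsilon|^{|Q|\cdot|S|}$: $w(q,s)\le|\Upsilon|^{|Q|\cdot|S|}$ and $w(q,s,\psi,\upsilon)\le|\Upsilon|^{|Q|\cdot|S|}$ for every reachable $(q,s)$ and all $\psi,\upsilon$. Moreover, the ranks can be taken bounded by $|Q^\bot|\cdot|S|$: there is a ranking $d'$, all of whose finite values are at most $|Q^\bot|\cdot|S|$, such that $(w,d')$ is also a combined weight-ranking. Furthermore, the problem of deciding, given ${\cal D}$, $B$ and $\upsilon_0$ (with explicitly listed transition tables), whether a memoryless combined weight-ranking exists is in NP. -/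

import Mathlib

/-! Transducers, deterministic Büchi word automata and memoryless combined weight-rankings. -/

namespace BuchiCover

/-- A deterministic transducer `⟨Ψ, Σ, Q, η, q₀, L⟩` with directions `Ψ`, output alphabet `Sig`,
states `Q`, a partial transition function `η`, an initial state and an output labelling `L`. -/
structure Transducer (Ψ Sig Q : Type*) where
  η : Q → Ψ → Option Q
  q₀ : Q
  L : Q → Sig

/-- A deterministic Büchi word automaton `⟨A, S, δ, s₀, F⟩` over the alphabet `A`, with a partial
transition function `δ` and the set `F` of Büchi states. -/
structure DBW (A S : Type*) where
  δ : S → A → Option S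
  s₀ : S
  F : Finset S

/-- The pairs `(q, s)` reached by joint runs of the transducer and the automaton: the first pair is
`(q₀, δ(s₀, (υ₀, L(q₀))))`, and `(q, s)` is followed by `(η(q, ψ), δ(s, (υ, L(η(q, ψ)))))`. -/
inductive JointReachable {Ψ Sig Υ Q S : Type*} (D : Transducer Ψ Sig Q) (B : DBW (Υ × Sig) S)
    (υ₀ : Υ) : Q → S → Prop
  | init {s : S} (hs : B.δ B.s₀ (υ₀, D.L D.q₀) = some s) : JointReachable D B υ₀ D.q₀ s
  | step {q q' : Q} {s s' : S} {ψ : Ψ} {υ : Υ} (h : JointReachable D B υ₀ q s)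
      (hq : D.η q ψ = some q') (hs : B.δ s (υ, D.L q') = some s') : JointReachable D B υ₀ q' s'

/-- `(w, d)` is a memoryless combined weight-ranking for `B` and `D` with branching `Υ` and root
direction `υ₀`. The weight function is split into its part `w` on `Q × S` and its part `wt` on
`Q × S × Ψ × Υ`; the ranking `d` lives on `(Q ∪ {q^⊥}) × S`, where `none` is `q^⊥`. -/
structure IsWeightRanking {Ψ Sig Υ Q S : Type*} [Fintype Ψ] [Fintype Υ]
    (D : Transducer Ψ Sig Q) (B : DBW (Υ × Sig) S) (υ₀ : Υ)
    (w : Q → S → ℕ) (wt : Q → S → Ψ → Υ → ℕ) (d : Option Q → S → ℕ∞) : Prop where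
  weight_init : ∃ s, B.δ B.s₀ (υ₀, D.L D.q₀) = some s ∧ w D.q₀ s = 1
  weight_real : ∀ q s ψ υ, 0 < wt q s ψ υ →
    ∃ q' s', D.η q ψ = some q' ∧ B.δ s (υ, D.L q') = some s'
  weight_total : ∀ q s, ∑ x : Ψ × Υ, wt q s x.1 x.2 ≤ Fintype.card Υ * w q s
  weight_dir : ∀ q s υ, ∑ ψ : Ψ, wt q s ψ υ ≤ w q s
  weight_target : ∀ q s ψ υ q' s', D.η q ψ = some q' → B.δ s (υ, D.L q') = some s' →
    w q' s' ≤ wt q s ψ υ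
  rank_init : ∃ s, B.δ B.s₀ (υ₀, D.L D.q₀) = some s ∧ d (some D.q₀) s ≠ ⊤
  rank_trans : ∀ q s υ, s ∉ B.F → d (some q) s ≠ ⊤ →
    ∀ ψ q' s', 0 < wt q s ψ υ → D.η q ψ = some q' → B.δ s (υ, D.L q') = some s' →
      d (some q') s' < d (some q) s
  rank_free : ∀ q s υ, s ∉ B.F → d (some q) s ≠ ⊤ → ∑ ψ : Ψ, wt q s ψ υ < w q s →
    ∃ σ s', B.δ s (υ, σ) = some s' ∧ d none s' < d (some q) s
  rank_trans_buchi : ∀ q s υ, s ∈ B.F → d (some q) s ≠ ⊤ →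
    ∀ ψ q' s', 0 < wt q s ψ υ → D.η q ψ = some q' → B.δ s (υ, D.L q') = some s' →
      d (some q') s' ≠ ⊤
  rank_free_buchi : ∀ q s υ, s ∈ B.F → d (some q) s ≠ ⊤ → ∑ ψ : Ψ, wt q s ψ υ < w q s →
    ∃ σ s', B.δ s (υ, σ) = some s' ∧ d none s' ≠ ⊤
  rank_bot : ∀ s, s ∉ B.F → d none s ≠ ⊤ →
    ∀ υ, ∃ σ s', B.δ s (υ, σ) = some s' ∧ d none s' < d none s
  rank_bot_buchi : ∀ s, s ∈ B.F → d none s ≠ ⊤ →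
    ∀ υ, ∃ σ s', B.δ s (υ, σ) = some s' ∧ d none s' ≠ ⊤

/-- A finite input of the decision problem: the state sets, alphabets and direction sets are
`{0, …, n - 1}`. -/
structure Instance where
  nΨ : ℕ
  nSig : ℕ
  nΥ : ℕ
  nQ : ℕ
  nS : ℕ
  D : Transducer (Fin nΨ) (Fin nSig) (Fin nQ)
  B : DBW (Fin nΥ × Fin nSig) (Fin nS)
  υ₀ : Fin nΥ

/-- The decision problem: does the instance have a memoryless combined weight-ranking? -/
def Instance.HasWeightRanking (I : Instance) : Prop :=
  ∃ w wt d, IsWeightRanking I.D I.B I.υ₀ w wt d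

/-- `0` for an undefined value, `i + 1` for the value `i`. -/
def optCode {n : ℕ} : Option (Fin n) → ℕ
  | none => 0
  | some i => i + 1

/-- An instance written out as a sequence of numbers: the five sizes, the three initial objects,
and then the tables of `L`, `η`, `F` and `δ`, entry by entry, each entry preceded by its
arguments. -/
def Instance.toNats (I : Instance) : List ℕ :=
  [I.nΨ, I.nSig, I.nΥ, I.nQ, I.nS, I.D.q₀, I.B.s₀, I.υ₀] ++
  ((List.finRange I.nQ).flatMap (fun q : Fin I.nQ => [(q : ℕ), (I.D.L q : ℕ)]) ++
  ((List.finRange I.nQ).flatMap (fun q : Fin I.nQ => (List.finRange I.nΨ).flatMap fun ψ : Fin I.nΨ =>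
    [(q : ℕ), (ψ : ℕ), optCode (I.D.η q ψ)]) ++
  ((List.finRange I.nS).flatMap (fun s : Fin I.nS => [(s : ℕ), if s ∈ I.B.F then 1 else 0]) ++
  (List.finRange I.nS).flatMap (fun s : Fin I.nS => (List.finRange I.nΥ).flatMap fun υ : Fin I.nΥ =>
    (List.finRange I.nSig).flatMap fun σ : Fin I.nSig =>
      [(s : ℕ), (υ : ℕ), (σ : ℕ), optCode (I.B.δ s (υ, σ))]))))

/-- A sequence of numbers as a binary word, the number `n` being the block `1ⁿ0`. As an instance
contains full transition tables, writing its numbers in unary changes its length only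
polynomially. -/
def natsToBits (l : List ℕ) : List Bool :=
  l.flatMap fun n => List.replicate n true ++ [false]

theorem natsToBits_injective : Function.Injective natsToBits := by
  have key : ∀ (m n : ℕ) (x y : List Bool),
      List.replicate m true ++ false :: x = List.replicate n true ++ false :: y →
        m = n ∧ x = y := by
    intro m
    induction m with
    | zero =>
      intro n x y h
      cases n with
      | zero => simpa using h
      | succ n => simp [List.replicate_succ] at h
    | succ m ih =>
      intro n x y h
      cases n with
      | zero => simp [List.replicate_succ] at h
      | succ n =>
        simp only [List.replicate_succ, List.cons_append, List.cons.injEq, true_and] at h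
        have := ih n x y h
        exact ⟨by rw [this.1], this.2⟩
  intro a
  induction a with
  | nil =>
    intro b h
    cases b with
    | nil => rfl
    | cons n b => simp [natsToBits] at h
  | cons m a ih =>
    intro b h
    cases b with
    | nil => simp [natsToBits] at h
    | cons n b =>
      simp only [natsToBits, List.flatMap_cons, List.append_assoc, List.singleton_append] at h
      obtain ⟨h1, h2⟩ := key _ _ _ _ h
      rw [h1, ih h2]

theorem flatMap_congr_inv {α β : Type*} {f g : α → List β} (l : List α)
    (hlen : ∀ a ∈ l, (f a).length = (g a).length) (h : l.flatMap f = l.flatMap g) :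
    ∀ a ∈ l, f a = g a := by
  induction l with
  | nil => simp
  | cons b l ih =>
    simp only [List.flatMap_cons] at h
    obtain ⟨h1, h2⟩ := List.append_inj h (hlen b (by simp))
    intro a ha
    rcases List.mem_cons.1 ha with rfl | ha
    · exact h1
    · exact ih (fun a ha => hlen a (by simp [ha])) h2 a ha

theorem optCode_injective {n : ℕ} : Function.Injective (optCode (n := n)) := by
  intro a b h
  cases a <;> cases b <;> simp_all [optCode, Fin.ext_iff]

theorem Instance.toNats_injective : Function.Injective Instance.toNats := by
  rintro ⟨a, b, c, q, s, ⟨η, q₀, L⟩, ⟨δ, s₀, F⟩, υ₀⟩ ⟨a', b', c', q', s', ⟨η', q₀', L'⟩, ⟨δ', s₀', F'⟩, υ₀'⟩ h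
  simp only [Instance.toNats, List.cons_append, List.cons.injEq, List.nil_append] at h
  obtain ⟨rfl, rfl, rfl, rfl, rfl, h1, h2, h3, h⟩ := h
  obtain ⟨hL, h⟩ := List.append_inj h (by simp)
  obtain ⟨hη, h⟩ := List.append_inj h (by simp [List.length_flatMap])
  obtain ⟨hF, hδ⟩ := List.append_inj h (by simp)
  have eL : L = L' := by
    funext x
    have := flatMap_congr_inv _ (by simp) hL x (List.mem_finRange x)
    simpa [Fin.ext_iff] using this
  have eη : η = η' := by
    funext x y
    have h1 := flatMap_congr_inv _ (by simp [List.length_flatMap]) hη x (List.mem_finRange x)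
    have h2 := flatMap_congr_inv _ (by simp) h1 y (List.mem_finRange y)
    exact optCode_injective (by simpa using h2)
  have eF : F = F' := by
    ext x
    have h1 := flatMap_congr_inv _ (by simp) hF x (List.mem_finRange x)
    by_cases hx : x ∈ F <;> by_cases hx' : x ∈ F' <;> simp_all
  have eδ : δ = δ' := by
    funext x y
    have h1 := flatMap_congr_inv _ (by simp [List.length_flatMap]) hδ x (List.mem_finRange x)
    have h2 := flatMap_congr_inv _ (by simp) h1 y.1 (List.mem_finRange y.1)
    have h3 := flatMap_congr_inv _ (by simp) h2 y.2 (List.mem_finRange y.2)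
    exact optCode_injective (by simpa using h3)
  have e1 := Fin.ext h1
  have e2 := Fin.ext h2
  have e3 := Fin.ext h3
  subst eL eη eF eδ e1 e2 e3
  rfl

open Classical in
/-- The encoding of instances as binary words. -/
noncomputable def instanceEncoding : Computability.Encoding Instance Bool where
  encode I := natsToBits I.toNats
  decode l := if h : ∃ I : Instance, natsToBits I.toNats = l then some h.choose else none
  decode_encode I := by
    have h : ∃ J : Instance, natsToBits J.toNats = natsToBits I.toNats := ⟨I, rfl⟩
    rw [dif_pos h]
    exact congrArg some (Instance.toNats_injective (natsToBits_injective h.choose_spec))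

/-- The decision problem `P` on objects encoded by `ea` is in NP: there are a polynomial `p` and a
verifier, computed by a Turing machine in time polynomial in the joint length of instance and
certificate, such that `P a` holds iff the verifier accepts `a` with some binary certificate of
length at most `p(|a|)`. -/
def InNP {α Γ : Type} [Finite Γ] (ea : Computability.Encoding α Γ) (P : α → Prop) : Prop :=
  ∃ (p : Polynomial ℕ) (V : α × List Bool → Bool),
    Nonempty (Turing.TM2ComputableInPolyTime
      (Computability.encodingProd ea (Computability.encodingList Bool)).encode
      Computability.encodeBool V) ∧
    ∀ a, P a ↔ ∃ c : List Bool, c.length ≤ p.eval (ea.encode a).length ∧ V (a, c) = true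

end BuchiCover

/-! Weights. The initial weight is `1`. Along a joint transition the weight of the target is at most
that of the transition, which is one summand of a sum bounded by the weight of the source. So every
reachable weight is at most `1` (`weight_le_one`), and `1 ≤ |Υ| ^ n` because `υ₀` makes `Υ`
nonempty.

Ranks. The conditions only compare ranks and ask whether they are finite, so each finite rank may be
replaced by the number of occurring values below it (`exists_bounded_rank`).

NP. The conditions also bind unreachable pairs, where weights may be forced to be exponentially
large. A certificate therefore records only the order of magnitude of the weights, as a class
ranking. For positive weights, two transitions from one pair in one direction are both strictly
lighter than the pair. Conversely, this property alone allows weights to be rebuilt as powers of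
`|Ψ| + 1`: either one transition carries the whole weight, or at most `|Ψ|` of them each carry at
most a fraction `1 / (|Ψ| + 1)` of it. The rank conditions need the exact test "sum `<` weight", but
only at weights `0` and `1`, which classes preserve; pairs of larger weight receive rank `∞`, which
frees them from rank conditions (`exists_isWeightRanking_iff`). All entries of a class ranking are
polynomially bounded, hence short even in unary.

Verification. Validity of a class ranking is a formula with bounded quantifiers over the numbers
written in the input. Such formulas become terms with bounded sums and products, whose values stay
polynomial in the length of the input. They are evaluated by programs on unary registers, and these
programs are translated into Turing machines step by step (`exists_bounded`, `Exec.steps`,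
`inNP_of_term`). -/

namespace BuchiCover

/-! ### Structured stack programs and their translation into Turing machines -/

/-- Structured programs acting on a family of stacks of Booleans. -/
inductive Prog
  | skip : Prog
  | push (k : ℕ) (b : Bool) : Prog
  | pop (k : ℕ) : Prog
  | seq (P R : Prog) : Prog
  | ite (k : ℕ) (f : Option Bool → Bool) (P R : Prog) : Prog
  | loop (k : ℕ) (P : Prog) : Prog

namespace Prog

/-- The stacks on which a program acts. -/
abbrev Stacks := ℕ → List Bool

/-- `Exec P s s' t`: started on the stacks `s`, the program `P` ends on the stacks `s'` after
exactly `t` steps. A loop runs as long as its stack is nonempty. -/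
inductive Exec : Prog → Stacks → Stacks → ℕ → Prop
  | skip (s : Stacks) : Exec skip s s 1
  | push (k : ℕ) (b : Bool) (s : Stacks) :
      Exec (push k b) s (Function.update s k (b :: s k)) 1
  | pop (k : ℕ) (s : Stacks) : Exec (pop k) s (Function.update s k (s k).tail) 1
  | seq {P R : Prog} {s s' s'' : Stacks} {t t' : ℕ} (h : Exec P s s' t) (h' : Exec R s' s'' t') :
      Exec (seq P R) s s'' (t + t')
  | iteTrue {k : ℕ} {f : Option Bool → Bool} {P R : Prog} {s s' : Stacks} {t : ℕ}
      (hf : f (s k).head? = true) (h : Exec P s s' t) : Exec (ite k f P R) s s' (1 + t)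
  | iteFalse {k : ℕ} {f : Option Bool → Bool} {P R : Prog} {s s' : Stacks} {t : ℕ}
      (hf : f (s k).head? = false) (h : Exec R s s' t) : Exec (ite k f P R) s s' (1 + t)
  | loopDone {k : ℕ} {P : Prog} {s : Stacks} (hs : s k = []) : Exec (loop k P) s s 1
  | loopStep {k : ℕ} {P : Prog} {s s' s'' : Stacks} {t t' : ℕ} (hs : s k ≠ [])
      (h : Exec P s s' t) (h' : Exec (loop k P) s' s'' t') : Exec (loop k P) s s'' (1 + t + t')

/-- A number that is at least as large as the index of any stack used by the program. -/
def bound : Prog → ℕ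
  | skip => 0
  | push k _ => k
  | pop k => k
  | seq P R => max P.bound R.bound
  | ite k _ P R => max k (max P.bound R.bound)
  | loop k P => max k P.bound

/-- The control points of a program. -/
def Lab : Prog → Type
  | skip => Unit
  | push _ _ => Unit
  | pop _ => Unit
  | seq P R => Lab P ⊕ Lab R
  | ite _ _ P R => Option (Lab P ⊕ Lab R)
  | loop _ P => Option (Lab P)

instance fintypeLab : (P : Prog) → Fintype (Lab P)
  | skip => inferInstanceAs (Fintype Unit)
  | push _ _ => inferInstanceAs (Fintype Unit)
  | pop _ => inferInstanceAs (Fintype Unit)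
  | seq P R =>
    letI := fintypeLab P
    letI := fintypeLab R
    inferInstanceAs (Fintype (Lab P ⊕ Lab R))
  | ite _ _ P R =>
    letI := fintypeLab P
    letI := fintypeLab R
    inferInstanceAs (Fintype (Option (Lab P ⊕ Lab R)))
  | loop _ P =>
    letI := fintypeLab P
    inferInstanceAs (Fintype (Option (Lab P)))

/-- The first control point of a program. -/
def entry : (P : Prog) → Lab P
  | skip => ()
  | push _ _ => ()
  | pop _ => ()
  | seq P _ => Sum.inl P.entry
  | ite _ _ _ _ => none
  | loop _ _ => none

/-- The alphabets of the machine: an input stack `none` and Boolean stacks `0, …, m`. -/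
abbrev Alph (m : ℕ) : Option (Fin (m + 1)) → Type
  | none => Bool ⊕ Bool
  | some _ => Bool

/-- The statement of the machine at each control point of `P`, where the control points are embedded
into a type `Λ` of labels and `ex` is the label at which to go on after `P`. -/
def code (m : ℕ) {Λ : Type} : (P : Prog) → (Lab P → Λ) → Λ → Lab P →
    Turing.TM2.Stmt (Alph m) Λ (Option Bool)
  | skip, _, ex, _ => .goto fun _ => ex
  | push k b, _, ex, _ => .push (some (Fin.ofNat (m + 1) k)) (fun _ => b) (.goto fun _ => ex)
  | pop k, _, ex, _ => .pop (some (Fin.ofNat (m + 1) k)) (fun v _ => v) (.goto fun _ => ex)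
  | seq P R, emb, ex, l =>
    match l with
    | Sum.inl l => code m P (fun x => emb (Sum.inl x)) (emb (Sum.inr R.entry)) l
    | Sum.inr l => code m R (fun x => emb (Sum.inr x)) ex l
  | ite k f P R, emb, ex, l =>
    match l with
    | none => .peek (some (Fin.ofNat (m + 1) k)) (fun _ o => if f o then some true else none)
        (.branch Option.isSome
          (.load (fun _ => none) (.goto fun _ => emb (some (Sum.inl P.entry))))
          (.load (fun _ => none) (.goto fun _ => emb (some (Sum.inr R.entry)))))
    | some (Sum.inl l) => code m P (fun x => emb (some (Sum.inl x))) ex l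
    | some (Sum.inr l) => code m R (fun x => emb (some (Sum.inr x))) ex l
  | loop k P, emb, ex, l =>
    match l with
    | none => .peek (some (Fin.ofNat (m + 1) k)) (fun _ o => o)
        (.branch Option.isSome
          (.load (fun _ => none) (.goto fun _ => emb (some P.entry)))
          (.load (fun _ => none) (.goto fun _ => ex)))
    | some l => code m P (fun x => emb (some x)) (emb none) l

theorem code_entry_ite (m : ℕ) {Λ : Type} (k : ℕ) (f : Option Bool → Bool) (P R : Prog)
    (emb : Lab (ite k f P R) → Λ) (ex : Λ) :
    code m (ite k f P R) emb ex (entry (ite k f P R)) =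
      .peek (some (Fin.ofNat (m + 1) k)) (fun _ o => if f o then some true else none)
        (.branch Option.isSome
          (.load (fun _ => none) (.goto fun _ => emb (some (Sum.inl P.entry))))
          (.load (fun _ => none) (.goto fun _ => emb (some (Sum.inr R.entry))))) := rfl

theorem code_entry_loop (m : ℕ) {Λ : Type} (k : ℕ) (P : Prog) (emb : Lab (loop k P) → Λ) (ex : Λ) :
    code m (loop k P) emb ex (entry (loop k P)) =
      .peek (some (Fin.ofNat (m + 1) k)) (fun _ o => o)
        (.branch Option.isSome
          (.load (fun _ => none) (.goto fun _ => emb (some P.entry)))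
          (.load (fun _ => none) (.goto fun _ => ex))) := rfl

/-- The stacks of the machine, given the input stack and the Boolean stacks. -/
def machineStacks (m : ℕ) (w : List (Bool ⊕ Bool)) (s : Stacks) :
    (k : Option (Fin (m + 1))) → List (Alph m k)
  | none => w
  | some i => s i

theorem machineStacks_some {m k : ℕ} (hk : k ≤ m) (w : List (Bool ⊕ Bool)) (s : Stacks) :
    machineStacks m w s (some (Fin.ofNat (m + 1) k)) = s k := by
  simp only [machineStacks, Fin.ofNat, Nat.mod_eq_of_lt (Nat.lt_succ_of_le hk)]

theorem update_machineStacks {m k : ℕ} (hk : k ≤ m) (w : List (Bool ⊕ Bool)) (s : Stacks)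
    (l : List Bool) :
    Function.update (machineStacks m w s) (some (Fin.ofNat (m + 1) k)) l =
      machineStacks m w (Function.update s k l) := by
  funext j
  rcases j with _ | i
  · rw [Function.update_of_ne (by simp)]
    rfl
  · by_cases h : i = Fin.ofNat (m + 1) k
    · subst h
      rw [Function.update_self, machineStacks_some hk, Function.update_self]
    · rw [Function.update_of_ne (by simpa using h)]
      have : (i : ℕ) ≠ k := by
        rintro rfl
        exact h (by ext; simp)
      simp [machineStacks, Function.update_of_ne this]

/-- `t` steps lead from `c` to `c'`. -/
def Steps {C : Type*} (f : C → Option C) (c : C) (t : ℕ) (c' : C) : Prop :=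
  (flip bind f)^[t] (some c) = some c'

theorem Steps.trans {C : Type*} {f : C → Option C} {c c' c'' : C} {t t' : ℕ}
    (h : Steps f c t c') (h' : Steps f c' t' c'') : Steps f c (t + t') c'' := by
  unfold Steps at *
  rw [add_comm, Function.iterate_add_apply, h, h']

theorem Steps.one {C : Type*} {f : C → Option C} {c c' : C} (h : f c = some c') :
    Steps f c 1 c' := by
  simpa [Steps, flip] using h

/-- Each unit of time in `Exec` is exactly one machine step, since a test with its branch and jump
forms a single statement. The invariant is that the internal state is `none` at every label: tests
store a symbol or a flag there, branch on it and erase it. The exit `ex` varies in the induction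
because subprograms continue at different labels. -/
theorem Exec.steps {P : Prog} {s s' : Stacks} {t : ℕ} (h : Exec P s s' t) {m : ℕ}
    (hm : P.bound ≤ m) {Λ : Type} (M : Λ → Turing.TM2.Stmt (Alph m) Λ (Option Bool))
    (emb : Lab P → Λ) (ex : Λ) (hM : ∀ l, M (emb l) = code m P emb ex l)
    (w : List (Bool ⊕ Bool)) :
    Steps (Turing.TM2.step M) ⟨some (emb P.entry), none, machineStacks m w s⟩ t
      ⟨some ex, none, machineStacks m w s'⟩ := by
  induction h generalizing ex with
  | skip s => exact Steps.one (by simp [hM, code])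
  | push k b s =>
    have hk : k ≤ m := hm
    refine Steps.one ?_
    simp only [Turing.TM2.step, hM, code, Turing.TM2.stepAux]
    rw [machineStacks_some hk, update_machineStacks hk]
  | pop k s =>
    have hk : k ≤ m := hm
    refine Steps.one ?_
    simp only [Turing.TM2.step, hM, code, Turing.TM2.stepAux]
    rw [machineStacks_some hk, update_machineStacks hk]
  | @seq P R s s' s'' t t' h h' ih ih' =>
    simp only [bound, max_le_iff] at hm
    exact (ih hm.1 _ _ (fun l => hM (Sum.inl l))).trans (ih' hm.2 _ _ (fun l => hM (Sum.inr l)))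
  | @iteTrue k f P R s s' t hf h ih =>
    simp only [bound, max_le_iff] at hm
    refine Steps.trans (Steps.one ?_) (ih hm.2.1 _ _ (fun l => hM (some (Sum.inl l))))
    simp only [Turing.TM2.step, hM, code_entry_ite, Turing.TM2.stepAux]
    rw [machineStacks_some hm.1, hf]
    rfl
  | @iteFalse k f P R s s' t hf h ih =>
    simp only [bound, max_le_iff] at hm
    refine Steps.trans (Steps.one ?_) (ih hm.2.2 _ _ (fun l => hM (some (Sum.inr l))))
    simp only [Turing.TM2.step, hM, code_entry_ite, Turing.TM2.stepAux]
    rw [machineStacks_some hm.1, hf]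
    rfl
  | @loopDone k P s hs =>
    simp only [bound, max_le_iff] at hm
    refine Steps.one ?_
    simp only [Turing.TM2.step, hM, code_entry_loop, Turing.TM2.stepAux]
    rw [machineStacks_some hm.1, hs]
    rfl
  | @loopStep k P s s' s'' t t' hs h h' ih ih' =>
    have hm' := hm
    simp only [bound, max_le_iff] at hm
    refine Steps.trans (Steps.trans (Steps.one ?_) (ih hm.2 _ _ (fun l => hM (some l))))
      (ih' hm' _ _ hM)
    simp only [Turing.TM2.step, hM, code_entry_loop, Turing.TM2.stepAux]
    rw [machineStacks_some hm.1]
    obtain ⟨b, l, hl⟩ := List.exists_cons_of_ne_nil hs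
    rw [hl]
    rfl

/-- The statements of a machine that copies its input, in reverse order, to stack `1` and then runs
`P`. -/
def machineCode (P : Prog) :
    Bool ⊕ Lab P → Turing.TM2.Stmt (Alph (P.bound + 1)) (Bool ⊕ Lab P) (Option Bool)
  | Sum.inl true => .pop none (fun _ o => Option.map (Sum.elim id id) o)
      (.branch Option.isSome
        (.push (some (Fin.ofNat (P.bound + 1 + 1) 1)) (fun v => v.getD false)
          (.load (fun _ => none) (.goto fun _ => Sum.inl true)))
        (.goto fun _ => Sum.inr P.entry))
  | Sum.inl false => .halt
  | Sum.inr l => code (P.bound + 1) P Sum.inr (Sum.inl false) l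

/-- The machine that copies its input, in reverse order, to stack `1` and then runs `P`; its output
is stack `0`. -/
def machine (P : Prog) : Turing.FinTM2 where
  K := Option (Fin (P.bound + 1 + 1))
  k₀ := none
  k₁ := some 0
  Γ := Alph (P.bound + 1)
  Λ := Bool ⊕ Lab P
  main := Sum.inl true
  σ := Option Bool
  initialState := none
  Γk₀Fin := inferInstanceAs (Fintype (Bool ⊕ Bool))
  m := P.machineCode

theorem update_machineStacks_none (m : ℕ) (w w' : List (Bool ⊕ Bool)) (s : Stacks) :
    Function.update (machineStacks m w s) none w' = machineStacks m w' s := by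
  funext j
  rcases j with _ | i
  · rw [Function.update_self]
    rfl
  · rw [Function.update_of_ne (by simp)]
    rfl

/-- One step per symbol, and one more to find the input empty. `Sum.elim id id` forgets whether a
bit belongs to the instance or to the certificate. -/
theorem machineCode_load (P : Prog) (w : List (Bool ⊕ Bool)) (s : Stacks) :
    Steps (Turing.TM2.step P.machineCode)
      ⟨some (Sum.inl true), none, machineStacks (P.bound + 1) w s⟩ (w.length + 1)
      ⟨some (Sum.inr P.entry), none, machineStacks (P.bound + 1) []
        (Function.update s 1 ((w.map (Sum.elim id id)).reverse ++ s 1))⟩ := by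
  induction w generalizing s with
  | nil =>
    refine Steps.one ?_
    simp only [Turing.TM2.step, machineCode, Turing.TM2.stepAux]
    rw [update_machineStacks_none]
    simp [machineStacks]
  | cons a w ih =>
    rw [List.length_cons, add_comm (w.length + 1) 1]
    refine Steps.trans (Steps.one ?_) (by
      simpa using ih (Function.update s 1 (Sum.elim id id a :: s 1)))
    simp only [Turing.TM2.step, machineCode, Turing.TM2.stepAux]
    rw [update_machineStacks_none, machineStacks_some (by omega), update_machineStacks (by omega)]
    simp [machineStacks]

theorem initList_machine (P : Prog) (w : List (Bool ⊕ Bool)) :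
    Turing.initList P.machine w =
      ⟨some (Sum.inl true), none, machineStacks (P.bound + 1) w fun _ => []⟩ := by
  unfold Turing.initList
  congr 1
  funext k
  rcases k with _ | i <;> rfl

theorem haltList_machine (P : Prog) (w : List Bool) :
    Turing.haltList P.machine w =
      ⟨none, none, machineStacks (P.bound + 1) [] (Function.update (fun _ => []) 0 w)⟩ := by
  unfold Turing.haltList
  congr 1
  funext k
  rcases k with _ | i
  · rfl
  · by_cases h : i = 0
    · subst h
      rfl
    · have h' : ¬ (some i = (some 0 : Option (Fin (P.bound + 1 + 1)))) := by simpa using h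
      have : (i : ℕ) ≠ 0 := fun e => h (Fin.ext e)
      refine (dif_neg h').trans ?_
      change [] = Function.update (fun _ => []) 0 w (i : ℕ)
      rw [Function.update_of_ne this]

/-- A program that, started with the reversed word `w` on stack `1`, ends with `v` on stack `0`
yields a machine that outputs `v` on the input `w`. -/
theorem Exec.outputsInTime {P : Prog} {w : List (Bool ⊕ Bool)} {v : List Bool} {t : ℕ}
    (h : Exec P (Function.update (fun _ => []) 1 (w.map (Sum.elim id id)).reverse)
      (Function.update (fun _ => []) 0 v) t) {T : ℕ} (hT : w.length + 1 + t + 1 ≤ T) :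
    Nonempty (Turing.TM2OutputsInTime P.machine w (some v) T) := by
  have h1 := machineCode_load P w fun _ => []
  have h2 := h.steps (Nat.le_succ _) P.machineCode Sum.inr (Sum.inl false) (fun _ => rfl) []
  have h3 : Steps (Turing.TM2.step P.machineCode)
      ⟨some (Sum.inl false), none,
        machineStacks (P.bound + 1) [] (Function.update (fun _ => []) 0 v)⟩ 1
      ⟨none, none, machineStacks (P.bound + 1) [] (Function.update (fun _ => []) 0 v)⟩ :=
    Steps.one (by simp [machineCode])
  simp only [List.append_nil] at h1
  have h4 := (h1.trans h2).trans h3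
  refine ⟨⟨⟨w.length + 1 + t + 1, ?_⟩, hT⟩⟩
  change _ = some (Turing.haltList P.machine v)
  rw [initList_machine, haltList_machine]
  exact h4

end Prog
namespace Prog

/-! ### Unary register arithmetic with time bounds -/

/-- `P` leads from the stacks `s` to the stacks `s'` in at most `T` steps. -/
def Runs (P : Prog) (s s' : Stacks) (T : ℕ) : Prop :=
  ∃ t ≤ T, Exec P s s' t

theorem Runs.mono {P : Prog} {s s' : Stacks} {T T' : ℕ} (h : Runs P s s' T) (hT : T ≤ T') :
    Runs P s s' T' := by
  obtain ⟨t, ht, h⟩ := h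
  exact ⟨t, ht.trans hT, h⟩

theorem Runs.skip (s : Stacks) : Runs skip s s 1 := ⟨1, le_rfl, .skip s⟩

theorem Runs.seq {P R : Prog} {s s' s'' : Stacks} {T T' : ℕ} (h : Runs P s s' T)
    (h' : Runs R s' s'' T') : Runs (seq P R) s s'' (T + T') := by
  obtain ⟨t, ht, h⟩ := h
  obtain ⟨t', ht', h'⟩ := h'
  exact ⟨t + t', by omega, h.seq h'⟩

theorem Runs.ite_true {k : ℕ} {f : Option Bool → Bool} {P R : Prog} {s s' : Stacks} {T : ℕ}
    (hf : f (s k).head? = true) (h : Runs P s s' T) : Runs (ite k f P R) s s' (T + 1) := by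
  obtain ⟨t, ht, h⟩ := h
  exact ⟨1 + t, by omega, .iteTrue hf h⟩

theorem Runs.ite_false {k : ℕ} {f : Option Bool → Bool} {P R : Prog} {s s' : Stacks} {T : ℕ}
    (hf : f (s k).head? = false) (h : Runs R s s' T) : Runs (ite k f P R) s s' (T + 1) := by
  obtain ⟨t, ht, h⟩ := h
  exact ⟨1 + t, by omega, .iteFalse hf h⟩

theorem Runs.loop_done {k : ℕ} {P : Prog} {s : Stacks} (hs : s k = []) :
    Runs (loop k P) s s 1 := ⟨1, le_rfl, .loopDone hs⟩

theorem Runs.loop_step {k : ℕ} {P : Prog} {s s' s'' : Stacks} {T T' : ℕ} (hs : s k ≠ [])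
    (h : Runs P s s' T) (h' : Runs (loop k P) s' s'' T') : Runs (loop k P) s s'' (T + 1 + T') := by
  obtain ⟨t, ht, h⟩ := h
  obtain ⟨t', ht', h'⟩ := h'
  exact ⟨1 + t + t', by omega, .loopStep hs h h'⟩

/-- The index counts the remaining iterations, so the loop passes through `f n, …, f 0`. This suits
loops that count a register down. -/
theorem Runs.loop {k : ℕ} {P : Prog} {f : ℕ → Stacks} {T : ℕ} (n : ℕ) (h0 : f 0 k = [])
    (h1 : ∀ j < n, f (j + 1) k ≠ []) (h : ∀ j < n, Runs P (f (j + 1)) (f j) T) :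
    Runs (loop k P) (f n) (f 0) (n * (T + 1) + 1) := by
  induction n with
  | zero => simpa using Runs.loop_done h0
  | succ n ih =>
    refine ((h n n.lt_succ_self).loop_step (h1 n n.lt_succ_self) (ih (fun j hj => h1 j (by omega))
      (fun j hj => h j (by omega)))).mono (le_of_eq ?_)
    ring

/-- The stacks with the words `A` and `B` on the stacks `0` and `1` and the numbers `ρ k`, in unary,
on the stacks `k + 2`, which we call registers. -/
def memory (A B : List Bool) (ρ : ℕ → ℕ) : Stacks
  | 0 => A
  | 1 => B
  | k + 2 => List.replicate (ρ k) true

@[simp] theorem memory_zero (A B : List Bool) (ρ : ℕ → ℕ) : memory A B ρ 0 = A := rfl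

@[simp] theorem memory_one (A B : List Bool) (ρ : ℕ → ℕ) : memory A B ρ 1 = B := rfl

@[simp] theorem memory_reg (A B : List Bool) (ρ : ℕ → ℕ) (k : ℕ) :
    memory A B ρ (k + 2) = List.replicate (ρ k) true := rfl

theorem update_memory_zero (A B A' : List Bool) (ρ : ℕ → ℕ) :
    Function.update (memory A B ρ) 0 A' = memory A' B ρ := by
  funext i
  rcases i with _ | _ | i <;> simp

theorem update_memory_one (A B B' : List Bool) (ρ : ℕ → ℕ) :
    Function.update (memory A B ρ) 1 B' = memory A B' ρ := by
  funext i
  rcases i with _ | _ | i <;> simp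

theorem update_memory_reg (A B : List Bool) (ρ : ℕ → ℕ) (k v : ℕ) :
    Function.update (memory A B ρ) (k + 2) (List.replicate v true) =
      memory A B (Function.update ρ k v) := by
  funext i
  rcases i with _ | _ | i
  · simp
  · simp
  · by_cases h : i = k <;> simp [h]

variable {A B A' B' : List Bool} {ρ ρ' : ℕ → ℕ}

theorem Runs.of_eq {P : Prog} {T T' : ℕ} {ρ₁ ρ₁' : ℕ → ℕ}
    (h : Runs P (memory A B ρ) (memory A' B' ρ') T) (h1 : ∀ i, ρ₁ i = ρ i)
    (h2 : ∀ i, ρ₁' i = ρ' i) (hT : T ≤ T') : Runs P (memory A B ρ₁) (memory A' B' ρ₁') T' := by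
  rw [funext h1, funext h2]
  exact h.mono hT

theorem runs_inc (A B : List Bool) (ρ : ℕ → ℕ) (k : ℕ) :
    Runs (push (k + 2) true) (memory A B ρ) (memory A B (Function.update ρ k (ρ k + 1))) 1 := by
  rw [← update_memory_reg, List.replicate_succ]
  exact ⟨1, le_rfl, .push _ _ _⟩

theorem runs_dec (A B : List Bool) (ρ : ℕ → ℕ) (k : ℕ) :
    Runs (pop (k + 2)) (memory A B ρ) (memory A B (Function.update ρ k (ρ k - 1))) 1 := by
  rw [← update_memory_reg, ← List.tail_replicate]
  exact ⟨1, le_rfl, .pop _ _⟩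

theorem runs_push_zero (A B : List Bool) (ρ : ℕ → ℕ) (b : Bool) :
    Runs (push 0 b) (memory A B ρ) (memory (b :: A) B ρ) 1 := by
  exact ⟨1, le_rfl, update_memory_zero A B (b :: A) ρ ▸ .push 0 b (memory A B ρ)⟩

theorem runs_push_one (A B : List Bool) (ρ : ℕ → ℕ) (b : Bool) :
    Runs (push 1 b) (memory A B ρ) (memory A (b :: B) ρ) 1 := by
  exact ⟨1, le_rfl, update_memory_one A B (b :: B) ρ ▸ .push 1 b (memory A B ρ)⟩

theorem runs_pop_zero (A B : List Bool) (ρ : ℕ → ℕ) (b : Bool) :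
    Runs (pop 0) (memory (b :: A) B ρ) (memory A B ρ) 1 := by
  exact ⟨1, le_rfl, update_memory_zero (b :: A) B A ρ ▸ .pop 0 (memory (b :: A) B ρ)⟩

theorem runs_pop_one (A B : List Bool) (ρ : ℕ → ℕ) (b : Bool) :
    Runs (pop 1) (memory A (b :: B) ρ) (memory A B ρ) 1 := by
  exact ⟨1, le_rfl, update_memory_one A (b :: B) B ρ ▸ .pop 1 (memory A (b :: B) ρ)⟩

/-- A loop that counts register `k` down. -/
theorem runs_loop_reg {k : ℕ} {P : Prog} {T : ℕ} (n : ℕ) (f : ℕ → ℕ → ℕ) (hf : ∀ j, f j k = j)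
    (h : ∀ j < n, Runs P (memory A B (f (j + 1))) (memory A B (f j)) T) :
    Runs (loop (k + 2) P) (memory A B (f n)) (memory A B (f 0)) (n * (T + 1) + 1) :=
  Runs.loop (f := fun j => memory A B (f j)) n (by simp [hf])
    (fun j _ => by simp [hf, List.replicate_succ]) h

/-- Add register `a` to register `b` and clear it. -/
def mv (a b : ℕ) : Prog := loop (a + 2) (seq (pop (a + 2)) (push (b + 2) true))

theorem runs_mv (A B : List Bool) (ρ : ℕ → ℕ) {a b : ℕ} (hab : a ≠ b) :
    Runs (mv a b) (memory A B ρ)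
      (memory A B (Function.update (Function.update ρ b (ρ b + ρ a)) a 0)) (3 * ρ a + 1) := by
  -- Invariant: when `j` is left in `a`, register `b` has received `ρ a - j`.
  have := runs_loop_reg (A := A) (B := B) (k := a) (P := seq (pop (a + 2)) (push (b + 2) true))
    (T := 2) (ρ a)
    (fun j => Function.update (Function.update ρ b (ρ b + (ρ a - j))) a j) (by simp) ?_
  · exact this.of_eq (by grind [Function.update_apply]) (by grind [Function.update_apply]) (by omega)
  · intro j hj
    exact ((runs_dec _ _ _ _).seq (runs_inc _ _ _ _)).of_eq
      (fun _ => rfl) (by grind [Function.update_apply]) (by omega)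

/-- Clear register `a`. -/
def clr (a : ℕ) : Prog := loop (a + 2) (pop (a + 2))

theorem runs_clr (A B : List Bool) (ρ : ℕ → ℕ) (a : ℕ) :
    Runs (clr a) (memory A B ρ) (memory A B (Function.update ρ a 0)) (2 * ρ a + 1) := by
  have := runs_loop_reg (A := A) (B := B) (k := a) (P := pop (a + 2))
    (T := 1) (ρ a) (fun j => Function.update ρ a j) (by simp) ?_
  · exact this.of_eq (by grind [Function.update_apply]) (by grind [Function.update_apply]) (by omega)
  · intro j hj
    exact (runs_dec _ _ _ _).of_eq
      (fun _ => rfl) (by grind [Function.update_apply]) (by omega)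

/-- Add register `a` to register `b`, using the empty register `c`. -/
def copy (a b c : ℕ) : Prog :=
  seq (loop (a + 2) (seq (pop (a + 2)) (seq (push (b + 2) true) (push (c + 2) true)))) (mv c a)

theorem runs_copy (A B : List Bool) (ρ : ℕ → ℕ) {a b c : ℕ} (hab : a ≠ b) (hac : a ≠ c)
    (hbc : b ≠ c) (hc : ρ c = 0) :
    Runs (copy a b c) (memory A B ρ) (memory A B (Function.update ρ b (ρ b + ρ a)))
      (7 * ρ a + 2) := by
  have := runs_loop_reg (A := A) (B := B) (k := a)
    (P := (seq (pop (a + 2)) (seq (push (b + 2) true) (push (c + 2) true))))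
    (T := 3) (ρ a)
    (fun j => Function.update (Function.update (Function.update ρ b (ρ b + (ρ a - j))) c (ρ a - j))
      a j) (by simp) ?_
  · have h2 := this.seq (runs_mv A B _ hac.symm)
    exact h2.of_eq (by grind [Function.update_apply]) (by grind [Function.update_apply])
      (by grind [Function.update_apply])
  · intro j hj
    exact ((runs_dec _ _ _ _).seq ((runs_inc _ _ _ _).seq (runs_inc _ _ _ _))).of_eq
      (fun _ => rfl) (by grind [Function.update_apply]) (by omega)

/-- Subtract register `a` from register `b` and clear it. -/
def subtract (a b : ℕ) : Prog := loop (a + 2) (seq (pop (a + 2)) (pop (b + 2)))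

theorem runs_subtract (A B : List Bool) (ρ : ℕ → ℕ) {a b : ℕ} (hab : a ≠ b) :
    Runs (subtract a b) (memory A B ρ)
      (memory A B (Function.update (Function.update ρ b (ρ b - ρ a)) a 0)) (3 * ρ a + 1) := by
  have := runs_loop_reg (A := A) (B := B) (k := a) (P := seq (pop (a + 2)) (pop (b + 2)))
    (T := 2) (ρ a)
    (fun j => Function.update (Function.update ρ b (ρ b - (ρ a - j))) a j) (by simp) ?_
  · exact this.of_eq (by grind [Function.update_apply]) (by grind [Function.update_apply]) (by omega)
  · intro j hj
    exact ((runs_dec _ _ _ _).seq (runs_dec _ _ _ _)).of_eq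
      (fun _ => rfl) (by grind [Function.update_apply]) (by omega)

/-- Replace register `k` by its product with register `k + 1`, which is cleared; the registers
`k + 2` and `k + 3` are assumed to be empty. -/
def multiply (k : ℕ) : Prog :=
  seq (loop (k + 2) (seq (pop (k + 2)) (copy (k + 1) (k + 2) (k + 3))))
    (seq (clr (k + 1)) (mv (k + 2) k))

theorem runs_multiply (A B : List Bool) (ρ : ℕ → ℕ) {k : ℕ} (h2 : ρ (k + 2) = 0)
    (h3 : ρ (k + 3) = 0) :
    Runs (multiply k) (memory A B ρ)
      (memory A B (Function.update (Function.update ρ k (ρ k * ρ (k + 1))) (k + 1) 0))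
      (ρ k * (7 * ρ (k + 1) + 4) + 1 + (2 * ρ (k + 1) + 1 + (3 * (ρ k * ρ (k + 1)) + 1))) := by
  -- Invariant: with `j` rounds to go, register `k + 2` holds `ρ k - j` copies of the second factor.
  have := runs_loop_reg (A := A) (B := B) (k := k)
    (P := seq (pop (k + 2)) (copy (k + 1) (k + 2) (k + 3)))
    (T := 7 * ρ (k + 1) + 3) (ρ k)
    (fun j => Function.update (Function.update ρ (k + 2) ((ρ k - j) * ρ (k + 1))) k j) (by simp) ?_
  · have h4 := this.seq ((runs_clr A B _ (k + 1)).seq (runs_mv A B _ (a := k + 2) (b := k)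
      (by omega)))
    exact h4.of_eq (by grind [Function.update_apply]) (by grind [Function.update_apply]) (by simp)
  · intro j hj
    have h5 := (runs_dec A B (Function.update (Function.update ρ (k + 2)
      ((ρ k - (j + 1)) * ρ (k + 1))) k (j + 1)) k).seq (runs_copy A B _ (a := k + 1) (b := k + 2)
        (c := k + 3) (by omega) (by omega) (by omega) (by simp [h3]))
    refine h5.of_eq (fun _ => rfl) (fun i => ?_) ?_
    -- Written as a successor, the truncated difference lets the product grow by exactly one copy of
    -- the factor.
    · have : ρ k - j = (ρ k - (j + 1)) + 1 := by omega
      rw [this]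
      simp only [Function.update_apply]
      grind
    · simp
      omega

/-! ### Random access to the unary numbers of a word -/

/-- The length of the `i`-th block of a sequence of unary numbers, where the blocks are numbered
from `1`. -/
def blockLength : List Bool → ℕ → ℕ
  | [], _ => 0
  | true :: A, i => (if i = 1 then 1 else 0) + blockLength A i
  | false :: A, i => blockLength A (i - 1)

/-- Index `0` means that the wanted block has been passed; truncated subtraction keeps it at `0`. -/
theorem blockLength_zero (A : List Bool) : blockLength A 0 = 0 := by
  induction A with
  | nil => rfl
  | cons b A ih => cases b <;> simp [blockLength, ih]

theorem blockLength_le (A : List Bool) (i : ℕ) : blockLength A i ≤ A.length := by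
  induction A generalizing i with
  | nil => simp [blockLength]
  | cons b A ih =>
    cases b
    · exact (ih _).trans (by simp)
    · simp only [blockLength, List.length_cons]
      have := ih i
      split_ifs <;> omega

theorem blockLength_replicate (n i : ℕ) (A : List Bool) :
    blockLength (List.replicate n true ++ A) i = (if i = 1 then n else 0) + blockLength A i := by
  induction n with
  | zero => simp
  | succ n ih =>
    simp only [List.replicate_succ, List.cons_append, blockLength, ih]
    split_ifs <;> omega

theorem blockLength_natsToBits (l : List ℕ) (A : List Bool) (i : ℕ) :
    blockLength (natsToBits l ++ A) (i + 1) =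
      if h : i < l.length then l[i] else blockLength A (i - l.length + 1) := by
  induction l generalizing i with
  | nil => simp [natsToBits]
  | cons n l ih =>
    simp only [natsToBits, List.flatMap_cons, List.append_assoc] at ih ⊢
    rw [blockLength_replicate]
    rcases i with _ | i
    · simp [blockLength, blockLength_zero]
    · simp only [List.singleton_append, blockLength]
      simp [ih]

/-- The loop body of the program that reads block number `ρ k` of the word on stack `0` into
register `k + 1`, moving the word to stack `1`. -/
def scanBody (k : ℕ) : Prog :=
  ite 0 (fun o => o == some true)
    (seq (pop 0) (seq (push 1 true) (ite (k + 2) Option.isSome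
      (seq (pop (k + 2)) (ite (k + 2) Option.isSome (push (k + 2) true)
        (seq (push (k + 2) true) (push (k + 1 + 2) true)))) skip)))
    (seq (pop 0) (seq (push 1 false) (pop (k + 2))))

theorem head?_reg_of_pos {k : ℕ} (h : 0 < ρ k) :
    Option.isSome (memory A B ρ (k + 2)).head? = true := by
  obtain ⟨n, hn⟩ := Nat.exists_eq_succ_of_ne_zero h.ne'
  simp [hn, List.replicate_succ]

theorem head?_reg_of_eq_zero {k : ℕ} (h : ρ k = 0) :
    Option.isSome (memory A B ρ (k + 2)).head? = false := by
  simp [h]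

/-- Register `k` is decremented at each separator, so it equals `1` exactly inside the wanted block.
The test for `1` pops once, looks whether anything is left, and restores the register. The final
content `r` is irrelevant, except that its bound limits the time to clear it. -/
theorem runs_scan (A B : List Bool) (ρ : ℕ → ℕ) (k : ℕ) :
    ∃ r ≤ ρ k, Runs (loop 0 (scanBody k)) (memory A B ρ)
      (memory [] (A.reverse ++ B) (Function.update (Function.update ρ k r) (k + 1)
        (ρ (k + 1) + blockLength A (ρ k)))) (9 * A.length + 1) := by
  induction A generalizing B ρ with
  | nil =>
    refine ⟨ρ k, le_rfl, ?_⟩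
    exact (Runs.loop_done (P := scanBody k) (s := memory [] B ρ) (k := 0) rfl).of_eq
      (fun _ => rfl) (by grind [blockLength, Function.update_apply]) (by omega)
  | cons b A ih =>
    cases b with
    | false =>
      obtain ⟨r, hr, ih⟩ := ih (false :: B) (Function.update ρ k (ρ k - 1))
      simp only [Function.update_self] at hr
      refine ⟨r, by omega, ?_⟩
      have h1 := Runs.ite_false (k := 0) (f := fun o => o == some true)
        (P := (seq (pop 0) (seq (push 1 true) (ite (k + 2) Option.isSome
          (seq (pop (k + 2)) (ite (k + 2) Option.isSome (push (k + 2) true)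
          (seq (push (k + 2) true) (push (k + 1 + 2) true)))) skip)))) rfl
        ((runs_pop_zero A B ρ false).seq ((runs_push_one A B ρ false).seq
          (runs_dec A (false :: B) ρ k)))
      have h2 := (Runs.loop_step (by simp) h1 ih).mono
        (T' := 9 * (false :: A).length + 1) (by simp; omega)
      rw [List.reverse_cons, List.append_assoc]
      refine h2.of_eq (fun _ => rfl) (fun i => ?_) le_rfl
      simp only [blockLength]
      grind [Function.update_apply]
    | true =>
      have key : Runs (scanBody k) (memory (true :: A) B ρ) (memory A (true :: B)
          (Function.update ρ (k + 1) (ρ (k + 1) + if ρ k = 1 then 1 else 0))) 8 := by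
        refine Runs.ite_true (T := 7) rfl (((runs_pop_zero A B ρ true).seq
          ((runs_push_one A B ρ true).seq (T' := 5) ?_)).mono (by omega))
        rcases Nat.eq_zero_or_pos (ρ k) with h0 | h0
        · refine (Runs.ite_false (head?_reg_of_eq_zero h0) ?_).mono (T := 2) (by omega)
          exact (Runs.skip _).of_eq (fun _ => rfl) (by grind [Function.update_apply]) (by omega)
        · refine Runs.ite_true (head?_reg_of_pos h0) ((runs_dec _ _ _ _).seq (T' := 3) ?_)
          by_cases h1 : ρ k = 1
          · refine Runs.ite_false (T := 2) (head?_reg_of_eq_zero (by simp [h1])) ?_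
            exact ((runs_inc _ _ _ k).seq (runs_inc _ _ _ (k + 1))).of_eq (fun _ => rfl)
              (by grind [Function.update_apply]) (by omega)
          · refine Runs.ite_true (T := 2) (head?_reg_of_pos (by simp; omega)) ?_
            exact (runs_inc _ _ _ k).of_eq (fun _ => rfl)
              (by grind [Function.update_apply]) (by omega)
      obtain ⟨r, hr, ih⟩ := ih (true :: B)
        (Function.update ρ (k + 1) (ρ (k + 1) + if ρ k = 1 then 1 else 0))
      refine ⟨r, by simpa using hr, ?_⟩
      have h2 := (Runs.loop_step (by simp) key ih).mono
        (T' := 9 * (true :: A).length + 1) (by simp; omega)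
      rw [List.reverse_cons, List.append_assoc]
      refine h2.of_eq (fun _ => rfl) (fun i => ?_) le_rfl
      simp only [blockLength]
      grind [Function.update_apply]

/-- Move stack `1` to stack `0`, in reverse order. -/
def rewind : Prog :=
  loop 1 (ite 1 (fun o => o == some true) (seq (pop 1) (push 0 true)) (seq (pop 1) (push 0 false)))

theorem runs_rewind (A B : List Bool) (ρ : ℕ → ℕ) :
    Runs rewind (memory A B ρ) (memory (B.reverse ++ A) [] ρ) (4 * B.length + 1) := by
  induction B generalizing A with
  | nil => exact Runs.loop_done rfl
  | cons b B ih =>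
    have key : Runs (ite 1 (fun o => o == some true) (seq (pop 1) (push 0 true))
        (seq (pop 1) (push 0 false))) (memory A (b :: B) ρ) (memory (b :: A) B ρ) 3 := by
      cases b
      · exact Runs.ite_false rfl ((runs_pop_one _ _ _ _).seq (runs_push_zero _ _ _ _))
      · exact Runs.ite_true rfl ((runs_pop_one _ _ _ _).seq (runs_push_zero _ _ _ _))
    have := (Runs.loop_step (by simp) key (ih (b :: A))).mono
      (T' := 4 * (b :: B).length + 1) (by simp; omega)
    rw [List.reverse_cons, List.append_assoc]
    exact this

/-- Replace the number `i` in register `k` by the `i`-th unary number on stack `0`, numbered from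
`0`; register `k + 1` is assumed to be empty. -/
def fetch (k : ℕ) : Prog :=
  seq (push (k + 2) true) (seq (loop 0 (scanBody k)) (seq rewind (seq (clr k) (mv (k + 1) k))))

/-- The first increment turns an index from `0` into a block number from `1`. The factor `16` is `9`
for the scan, `4` for the rewinding and `3` for moving the number found, which is at most the length
of the word. -/
theorem runs_fetch (A : List Bool) (ρ : ℕ → ℕ) {k : ℕ} (h : ρ (k + 1) = 0) :
    Runs (fetch k) (memory A [] ρ)
      (memory A [] (Function.update ρ k (blockLength A (ρ k + 1))))
      (16 * A.length + 2 * ρ k + 7) := by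
  obtain ⟨r, hr, h1⟩ := runs_scan A [] (Function.update ρ k (ρ k + 1)) k
  have h2 := ((runs_inc A [] ρ k).seq (h1.seq ((runs_rewind _ _ _).seq ((runs_clr _ _ _ k).seq
    (runs_mv _ _ _ (a := k + 1) (b := k) (by omega))))))
  simp only [List.append_nil, List.reverse_reverse] at h2
  refine h2.of_eq (fun _ => rfl) (by grind [Function.update_apply]) ?_
  · have := blockLength_le A (ρ k + 1)
    simp [h] at hr ⊢
    omega

end Prog
-- Bounded arithmetic and its evaluation in polynomial time
/-- Terms of bounded arithmetic over a word: variables, constants, sum, truncated difference,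
product, the `i`-th unary number of the word, and the sum of `t` over all `x < b`. -/
inductive Term
  | var (x : ℕ) : Term
  | const (c : ℕ) : Term
  | add (a b : Term) : Term
  | sub (a b : Term) : Term
  | mul (a b : Term) : Term
  | get (a : Term) : Term
  | sum (x : ℕ) (b t : Term) : Term

namespace Term

open Prog

/-- The value of a term on the word `A` in the environment `ρ`. -/
def eval (A : List Bool) : Term → (ℕ → ℕ) → ℕ
  | var x, ρ => ρ x
  | const c, _ => c
  | add a b, ρ => a.eval A ρ + b.eval A ρ
  | sub a b, ρ => a.eval A ρ - b.eval A ρ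
  | mul a b, ρ => a.eval A ρ * b.eval A ρ
  | get a, ρ => blockLength A (a.eval A ρ + 1)
  | sum x b t, ρ => ∑ i ∈ Finset.range (b.eval A ρ), t.eval A (Function.update ρ x i)

/-- A strict upper bound for the variables of a term. -/
def vars : Term → ℕ
  | var x => x + 1
  | const _ => 0
  | add a b => max a.vars b.vars
  | sub a b => max a.vars b.vars
  | mul a b => max a.vars b.vars
  | get a => a.vars
  | sum x b t => max (x + 1) (max b.vars t.vars)

/-- Registers beyond the variables of a term may thus serve as scratch space. In `vars` the bound
variable of a sum is counted too, because its register is the loop counter. -/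
theorem eval_congr (A : List Bool) (t : Term) {n : ℕ} (hn : t.vars ≤ n) {ρ ρ' : ℕ → ℕ}
    (h : ∀ i < n, ρ i = ρ' i) : t.eval A ρ = t.eval A ρ' := by
  induction t generalizing ρ ρ' with
  | var x => exact h x hn
  | const c => rfl
  | add a b iha ihb | sub a b iha ihb | mul a b iha ihb =>
    simp only [vars, max_le_iff] at hn
    simp only [eval, iha hn.1 h, ihb hn.2 h]
  | get a iha => simp only [eval, iha hn h]
  | sum x b t ihb iht =>
    simp only [vars, max_le_iff] at hn
    simp only [eval, ihb hn.2.1 h]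
    refine Finset.sum_congr rfl fun i _ => iht hn.2.2 fun j hj => ?_
    simp only [Function.update_apply, h j hj]

/-- Add `c` to register `k`. -/
def addConst (k : ℕ) : ℕ → Prog
  | 0 => .skip
  | c + 1 => .seq (.push (k + 2) true) (addConst k c)

theorem runs_addConst (A B : List Bool) (ρ : ℕ → ℕ) (k c : ℕ) :
    Runs (addConst k c) (memory A B ρ) (memory A B (Function.update ρ k (ρ k + c))) (c + 1) := by
  induction c generalizing ρ with
  | zero => exact (Runs.skip _).of_eq (fun _ => rfl) (by simp) le_rfl
  | succ c ih =>
    exact ((runs_inc A B ρ k).seq (ih _)).of_eq (fun _ => rfl)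
      (by grind [Function.update_apply]) (by omega)

/-- The program that evaluates a term into register `k`, using the registers from `k` on. -/
def compile : Term → ℕ → Prog
  | var x, k => copy x k (k + 1)
  | const c, k => addConst k c
  | add a b, k => .seq (a.compile k) (.seq (b.compile (k + 1)) (mv (k + 1) k))
  | sub a b, k => .seq (a.compile k) (.seq (b.compile (k + 1)) (subtract (k + 1) k))
  | mul a b, k => .seq (a.compile k) (.seq (b.compile (k + 1)) (multiply k))
  | get a, k => .seq (a.compile k) (fetch k)
  | sum x b t, k => .seq (b.compile k) (.seq (mv x (k + 1)) (.seq
      (.loop (k + 2) (.seq (.pop (k + 2)) (.seq (t.compile (k + 3)) (.seq (mv (k + 3) (k + 2))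
        (.push (x + 2) true)))))
      (.seq (clr x) (.seq (mv (k + 1) x) (mv (k + 2) k)))))

/-- `v` and `T` bound the values of `t` and the time to compute them, whenever the word has at most
the length `M` and the first `n` registers are at most `M`. -/
def Bounded (t : Term) (n M v T : ℕ) : Prop :=
  ∀ (A : List Bool) (ρ : ℕ → ℕ), A.length ≤ M → (∀ i < n, ρ i ≤ M) → t.eval A ρ ≤ v ∧
    ∀ k, n ≤ k → (∀ j, k ≤ j → ρ j = 0) →
      Runs (t.compile k) (memory A [] ρ) (memory A [] (Function.update ρ k (t.eval A ρ))) T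

/-- Evaluate `a` into register `k` and `b` into register `k + 1`. -/
theorem runs_pair {a b : Term} {n M va vb Ta Tb : ℕ} (ha : a.Bounded n M va Ta)
    (hb : b.Bounded n M vb Tb) (hbn : b.vars ≤ n) {A : List Bool} {ρ : ℕ → ℕ} (hA : A.length ≤ M)
    (hρ : ∀ i < n, ρ i ≤ M) {k : ℕ} (hk : n ≤ k) (h0 : ∀ j, k ≤ j → ρ j = 0) {P : Prog}
    {s : Stacks} {T : ℕ} (hP : Runs P (memory A [] (Function.update (Function.update ρ k (a.eval A ρ))
      (k + 1) (b.eval A ρ))) s T) :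
    Runs (.seq (a.compile k) (.seq (b.compile (k + 1)) P)) (memory A [] ρ) s (Ta + (Tb + T)) := by
  refine ((ha A ρ hA hρ).2 k hk h0).seq (Runs.seq (s' := _) ?_ hP)
  have := (hb A (Function.update ρ k (a.eval A ρ)) hA
    (fun i hi => by rw [Function.update_of_ne (by omega)]; exact hρ i hi)).2 (k + 1) (by omega)
    (fun j hj => by rw [Function.update_of_ne (by omega)]; exact h0 j (by omega))
  rwa [eval_congr A b hbn (ρ := Function.update ρ k (a.eval A ρ)) (ρ' := ρ)
    (fun i hi => by rw [Function.update_of_ne (by omega)])] at this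

theorem Bounded.add {a b : Term} {n M va vb Ta Tb : ℕ} (ha : a.Bounded n M va Ta)
    (hb : b.Bounded n M vb Tb) (hbn : b.vars ≤ n) :
    (add a b).Bounded n M (va + vb) (Ta + (Tb + (3 * vb + 1))) := by
  intro A ρ hA hρ
  have h1 := (ha A ρ hA hρ).1
  have h2 := (hb A ρ hA hρ).1
  refine ⟨Nat.add_le_add h1 h2, fun k hk h0 => runs_pair ha hb hbn hA hρ hk h0 ?_⟩
  exact (runs_mv _ _ _ (by omega)).of_eq (fun _ => rfl)
    (by grind [Function.update_apply, eval]) (by simpa using h2)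

theorem Bounded.sub {a b : Term} {n M va vb Ta Tb : ℕ} (ha : a.Bounded n M va Ta)
    (hb : b.Bounded n M vb Tb) (hbn : b.vars ≤ n) :
    (sub a b).Bounded n M va (Ta + (Tb + (3 * vb + 1))) := by
  intro A ρ hA hρ
  have h1 := (ha A ρ hA hρ).1
  have h2 := (hb A ρ hA hρ).1
  refine ⟨(Nat.sub_le _ _).trans h1, fun k hk h0 => runs_pair ha hb hbn hA hρ hk h0 ?_⟩
  exact (runs_subtract _ _ _ (by omega)).of_eq (fun _ => rfl)
    (by grind [Function.update_apply, eval]) (by simpa using h2)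

theorem Bounded.mul {a b : Term} {n M va vb Ta Tb : ℕ} (ha : a.Bounded n M va Ta)
    (hb : b.Bounded n M vb Tb) (hbn : b.vars ≤ n) :
    (mul a b).Bounded n M (va * vb)
      (Ta + (Tb + (va * (7 * vb + 4) + 1 + (2 * vb + 1 + (3 * (va * vb) + 1))))) := by
  intro A ρ hA hρ
  have h1 := (ha A ρ hA hρ).1
  have h2 := (hb A ρ hA hρ).1
  refine ⟨Nat.mul_le_mul h1 h2, fun k hk h0 => runs_pair ha hb hbn hA hρ hk h0 ?_⟩
  refine (runs_multiply _ _ _ ?_ ?_).of_eq (fun _ => rfl) ?_ ?_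
  · simpa using h0 (k + 2) (by omega)
  · simpa using h0 (k + 3) (by omega)
  · grind [Function.update_apply, eval]
  · simp
    gcongr

theorem Bounded.get {a : Term} {n M va Ta : ℕ} (ha : a.Bounded n M va Ta) :
    (get a).Bounded n M M (Ta + (16 * M + 2 * va + 7)) := by
  intro A ρ hA hρ
  have h1 := (ha A ρ hA hρ).1
  refine ⟨(blockLength_le _ _).trans hA, fun k hk h0 => ((ha A ρ hA hρ).2 k hk h0).seq ?_⟩
  refine (runs_fetch _ _ ?_).of_eq (fun _ => rfl) ?_ ?_
  · simpa using h0 (k + 1) (by omega)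
  · grind [Function.update_apply, eval]
  · simp
    omega

/-- The summation variable lives in register `x`; its old value is parked in `k + 1`, the partial
sum in `k + 2`, and summands are evaluated from `k + 3` on. Inside the loop `x` may exceed `M` but
stays below `vb`, hence the hypothesis on `t` at `M + vb`. -/
theorem Bounded.sum {x : ℕ} {b t : Term} {n M vb Tb vt Tt : ℕ} (hb : b.Bounded n M vb Tb)
    (ht : t.Bounded n (M + vb) vt Tt) (hx : x < n) (htn : t.vars ≤ n) :
    (sum x b t).Bounded n M (vb * vt) (Tb + ((3 * M + 1) + ((vb * (Tt + 3 * vt + 4) + 1) +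
      ((2 * vb + 1) + ((3 * M + 1) + (3 * (vb * vt) + 1)))))) := by
  intro A ρ hA hρ
  obtain ⟨h1, h2⟩ := hb A ρ hA hρ
  have hval : ∀ i < b.eval A ρ, t.eval A (Function.update ρ x i) ≤ vt := fun i hi =>
    (ht A _ (by omega) (fun j hj => by
      have := hρ j hj
      grind [Function.update_apply])).1
  have hsum : ∀ m ≤ b.eval A ρ,
      ∑ i ∈ Finset.range m, t.eval A (Function.update ρ x i) ≤ m * vt := fun m hm => by
    simpa using Finset.sum_le_card_nsmul (Finset.range m) _ vt
      (fun i hi => hval i (by simp at hi; omega))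
  refine ⟨(hsum _ le_rfl).trans (Nat.mul_le_mul_right _ h1), fun k hk h0 => ?_⟩
  have hk0 := h0 k le_rfl
  have hk1 := h0 (k + 1) (by omega)
  have hk2 := h0 (k + 2) (by omega)
  refine (h2 k hk h0).seq ?_
  set v := b.eval A ρ with hv
  -- The partial sums are made opaque, leaving only their recursion for `grind`.
  obtain ⟨S, hS0, hSs, hSv⟩ : ∃ S : ℕ → ℕ, S 0 = 0 ∧
      (∀ m, S (m + 1) = S m + t.eval A (Function.update ρ x m)) ∧
      S v = (Term.sum x b t).eval A ρ :=
    ⟨fun m => ∑ i ∈ Finset.range m, t.eval A (Function.update ρ x i), rfl,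
      fun m => Finset.sum_range_succ _ _, rfl⟩
  have hSle : S v ≤ vb * vt := hSv ▸ (hsum v le_rfl).trans (Nat.mul_le_mul_right vt h1)
  clear_value v
  -- The registers with `j` rounds to go: `v - j` summands have been added, and `x` holds the index
  -- of the next one.
  let σ : ℕ → ℕ → ℕ := fun j => Function.update (Function.update (Function.update
    (Function.update ρ k j) (k + 1) (ρ x)) (k + 2) (S (v - j))) x (v - j)
  have hstart : Runs (mv x (k + 1)) (memory A [] (Function.update ρ k v)) (memory A [] (σ v))
      (3 * M + 1) := by
    have := hρ x hx
    refine (runs_mv A [] (Function.update ρ k v) (a := x) (b := k + 1) (by omega)).of_eq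
      (fun _ => rfl) ?_ ?_
    · grind [Function.update_apply]
    · rw [Function.update_of_ne (by omega)]
      omega
  have hloop : Runs (.loop (k + 2) (.seq (.pop (k + 2)) (.seq (t.compile (k + 3))
      (.seq (mv (k + 3) (k + 2)) (.push (x + 2) true))))) (memory A [] (σ v)) (memory A [] (σ 0))
      (v * ((Tt + 3 * vt + 3) + 1) + 1) := by
    refine runs_loop_reg v σ (fun j => by grind [Function.update_apply]) fun j hj => ?_
    have hev : t.eval A (Function.update (σ (j + 1)) k (σ (j + 1) k - 1)) =
        t.eval A (Function.update ρ x (v - (j + 1))) :=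
      eval_congr A t htn fun i hi => by grind [Function.update_apply]
    have hbody := (ht A (Function.update (σ (j + 1)) k (σ (j + 1) k - 1)) (by omega)
      (fun i hi => by
        have := hρ i hi
        grind [Function.update_apply])).2 (k + 3) (by omega) (fun i hi => by
        have := h0 i (by omega)
        grind [Function.update_apply])
    rw [hev] at hbody
    have hle := hval (v - (j + 1)) (by omega)
    refine ((runs_dec _ _ _ _).seq (hbody.seq ((runs_mv _ _ _ (a := k + 3) (b := k + 2)
      (by omega)).seq (runs_inc _ _ _ x)))).of_eq (fun _ => rfl) (fun i => ?_) ?_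
    · have h3 := h0 (k + 3) (by omega)
      have hS := hSs (v - (j + 1))
      have e1 : v - j = v - (j + 1) + 1 := by omega
      simp only [σ, e1, hS]
      generalize t.eval A (Function.update ρ x (v - (j + 1))) = u
      generalize v - (j + 1) = w
      simp only [Function.update_apply]
      grind
    · rw [Function.update_self]
      omega
  refine hstart.seq (Runs.seq (hloop.mono (by gcongr)) ?_)
  refine ((runs_clr A [] (σ 0) x).seq ((runs_mv A [] _ (a := k + 1) (b := x) (by omega)).seq
    (runs_mv A [] _ (a := k + 2) (b := k) (by omega)))).of_eq (fun _ => rfl) (fun i => ?_) ?_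
  · rw [← hSv]
    simp only [Function.update_apply, σ, Nat.sub_zero]
    clear hstart hloop h2 hv hsum hval hSv hSs hSle
    generalize S v = u
    grind
  · have := hρ x hx
    have e1 : σ 0 x = v := by grind [Function.update_apply]
    have e2 : Function.update (σ 0) x 0 (k + 1) = ρ x := by grind [Function.update_apply]
    have e3 : ∀ u, Function.update (Function.update (Function.update (σ 0) x 0) x u) (k + 1) 0
      (k + 2) = S v := by grind [Function.update_apply]
    rw [e1, e2, e3]
    omega

/-- For a fixed term the nesting of sums is fixed, and each one only composes the bounds of its
summand with `X + pb`, so values and times remain polynomial. -/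
theorem exists_bounded (t : Term) {n : ℕ} (hn : t.vars ≤ n) :
    ∃ p q : Polynomial ℕ, ∀ M, t.Bounded n M (p.eval M) (q.eval M) := by
  induction t with
  | var x =>
    refine ⟨.X, 7 * .X + 2, fun M A ρ hA hρ => ?_⟩
    have hx := hρ x hn
    refine ⟨by simpa [eval] using hx, fun k hk h0 => ?_⟩
    have h1 := h0 k le_rfl
    have hxk : x < k := lt_of_lt_of_le hn hk
    refine (runs_copy A [] ρ (by omega) (by omega) (by omega) (h0 (k + 1) (by omega))).of_eq
      (fun _ => rfl) (by grind [eval]) (by simpa using hx)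
  | const c =>
    refine ⟨.C c, .C c + 1, fun M A ρ hA hρ => ⟨by simp [eval], fun k hk h0 => ?_⟩⟩
    have h1 := h0 k le_rfl
    exact (runs_addConst A [] ρ k c).of_eq (fun _ => rfl) (by grind [eval]) (by simp)
  | add a b iha ihb =>
    simp only [vars, max_le_iff] at hn
    obtain ⟨pa, qa, ha⟩ := iha hn.1
    obtain ⟨pb, qb, hb⟩ := ihb hn.2
    refine ⟨pa + pb, qa + (qb + (3 * pb + 1)), fun M => ?_⟩
    simpa using (ha M).add (hb M) hn.2
  | sub a b iha ihb =>
    simp only [vars, max_le_iff] at hn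
    obtain ⟨pa, qa, ha⟩ := iha hn.1
    obtain ⟨pb, qb, hb⟩ := ihb hn.2
    refine ⟨pa, qa + (qb + (3 * pb + 1)), fun M => ?_⟩
    simpa using (ha M).sub (hb M) hn.2
  | mul a b iha ihb =>
    simp only [vars, max_le_iff] at hn
    obtain ⟨pa, qa, ha⟩ := iha hn.1
    obtain ⟨pb, qb, hb⟩ := ihb hn.2
    refine ⟨pa * pb, qa + (qb + (pa * (7 * pb + 4) + 1 + (2 * pb + 1 + (3 * (pa * pb) + 1)))),
      fun M => ?_⟩
    simpa using (ha M).mul (hb M) hn.2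
  | get a iha =>
    obtain ⟨pa, qa, ha⟩ := iha hn
    refine ⟨.X, qa + (16 * .X + 2 * pa + 7), fun M => ?_⟩
    simpa using (ha M).get
  | sum x b t ihb iht =>
    simp only [vars, max_le_iff] at hn
    obtain ⟨pb, qb, hb⟩ := ihb hn.2.1
    obtain ⟨pt, qt, ht⟩ := iht hn.2.2
    refine ⟨pb * pt.comp (.X + pb), qb + ((3 * .X + 1) + ((pb * (qt.comp (.X + pb) +
      3 * pt.comp (.X + pb) + 4) + 1) + ((2 * pb + 1) + ((3 * .X + 1) +
      (3 * (pb * pt.comp (.X + pb)) + 1))))), fun M => ?_⟩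
    simpa using (hb M).sum (ht (M + pb.eval M)) hn.1 hn.2.2

/-! ### From terms to membership in NP -/

/-- The program that decides whether the value of a term is positive: it starts with the reversed
word on stack `1` and ends with the answer on stack `0`. -/
def decider (t : Term) : Prog :=
  .seq rewind (.seq (t.compile t.vars) (.ite (t.vars + 2) Option.isSome
    (.seq (clr t.vars) (.seq (.loop 0 (.pop 0)) (.push 0 true)))
    (.seq (.loop 0 (.pop 0)) (.push 0 false))))

theorem runs_clear_word (A : List Bool) (ρ : ℕ → ℕ) :
    Runs (.loop 0 (.pop 0)) (memory A [] ρ) (memory [] [] ρ) (2 * A.length + 1) := by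
  induction A with
  | nil => exact Runs.loop_done rfl
  | cons b A ih =>
    exact (Runs.loop_step (by simp) (runs_pop_zero A [] ρ b) ih).mono (by simp; omega)

theorem memory_eq_update_zero (A : List Bool) :
    memory A [] (fun _ => 0) = Function.update (fun _ => []) 0 A := by
  funext i
  rcases i with _ | _ | i <;> simp [memory]

theorem memory_eq_update_one (B : List Bool) :
    memory [] B (fun _ => 0) = Function.update (fun _ => []) 1 B := by
  funext i
  rcases i with _ | _ | i <;> simp [memory]

/-- The result must match a halting configuration, where every stack but the output is empty. Hence
the word and the result register are cleared before the answer is written. -/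
theorem exists_decider_time (t : Term) : ∃ p : Polynomial ℕ, ∀ A : List Bool,
    Runs t.decider (Function.update (fun _ => []) 1 A.reverse)
      (Function.update (fun _ => []) 0 [decide (t.eval A (fun _ => 0) ≠ 0)])
      (p.eval A.length) := by
  obtain ⟨p, q, h⟩ := t.exists_bounded le_rfl
  refine ⟨(4 * .X + 1) + (q + ((2 * p + 1 + (2 * .X + 1 + 1)) + 1)), fun A => ?_⟩
  obtain ⟨hv, hr⟩ := h A.length A (fun _ => 0) le_rfl (fun _ _ => Nat.zero_le _)
  have h1 := runs_rewind [] A.reverse (fun _ => 0)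
  have h2 := hr t.vars le_rfl (fun _ _ => rfl)
  simp only [List.reverse_reverse, List.append_nil, List.length_reverse] at h1
  rw [← memory_eq_update_one, ← memory_eq_update_zero]
  refine (h1.seq (h2.seq (T' := (2 * p.eval A.length + 1 + (2 * A.length + 1 + 1)) + 1) ?_)).mono
    (by simp)
  by_cases h0 : t.eval A (fun _ => 0) = 0
  · refine Runs.ite_false (head?_reg_of_eq_zero (by simpa using h0)) ?_
    rw [h0]
    refine ((runs_clear_word A _).seq (runs_push_zero _ _ _ _)).of_eq (fun _ => rfl) (fun i => ?_)
      (by omega)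
    simp [Function.update_apply]
  · refine Runs.ite_true (head?_reg_of_pos (by simpa using Nat.pos_of_ne_zero h0)) ?_
    rw [decide_eq_true h0]
    refine ((runs_clr A [] _ t.vars).seq ((runs_clear_word A _).seq (runs_push_zero _ _ _ _))).of_eq
      (fun _ => rfl) (by grind [Function.update_apply]) (by simpa using hv)

end Term

/-- A problem is in NP if its yes-instances are those for which some short word, appended to the
instance, makes a term of bounded arithmetic positive. -/
theorem inNP_of_term {α : Type} (ea : Computability.Encoding α Bool) (P : α → Prop) (t : Term)
    (p : Polynomial ℕ) (h : ∀ a, P a ↔ ∃ c : List Bool, c.length ≤ p.eval (ea.encode a).length ∧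
      t.eval (ea.encode a ++ c) (fun _ => 0) ≠ 0) : InNP ea P := by
  obtain ⟨q, hq⟩ := t.exists_decider_time
  refine ⟨p, fun x => decide (t.eval (ea.encode x.1 ++ x.2) (fun _ => 0) ≠ 0), ?_, fun a => ?_⟩
  · refine ⟨⟨⟨t.decider.machine, Equiv.refl _, Equiv.refl _⟩, .X + 1 + q + 1, fun x => ?_⟩⟩
    refine Classical.choice ?_
    obtain ⟨s, hs, he⟩ := hq (ea.encode x.1 ++ x.2)
    -- The encoding of pairs tags the bits of its two components; without tags it is plain
    -- concatenation.
    have hw : List.map (Sum.elim id id) ((Computability.encodingProd ea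
        (Computability.encodingList Bool)).encode x) = ea.encode x.1 ++ x.2 := by
      simp [Computability.encodingProd, Computability.encodingList]
    have hl : ((Computability.encodingProd ea (Computability.encodingList Bool)).encode x).length =
        (ea.encode x.1 ++ x.2).length := by
      rw [← hw, List.length_map]
    rw [← hw] at he
    have := he.outputsInTime (T := (.X + 1 + q + 1 : Polynomial ℕ).eval
      ((Computability.encodingProd ea (Computability.encodingList Bool)).encode x).length) (by
        simp only [Polynomial.eval_add, Polynomial.eval_X, Polynomial.eval_one, hl]
        omega)
    rw [hw] at this
    -- The machine is fed the encoding mapped by the identification of alphabets, which is the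
    -- identity here.
    have key : ∀ w : List (Bool ⊕ Bool), w = (Computability.encodingProd ea
        (Computability.encodingList Bool)).encode x → Nonempty (Turing.TM2OutputsInTime
          t.decider.machine w (some [decide (t.eval (ea.encode x.1 ++ x.2) (fun _ => 0) ≠ 0)])
          ((.X + 1 + q + 1 : Polynomial ℕ).eval ((Computability.encodingProd ea
            (Computability.encodingList Bool)).encode x).length)) := by
      rintro _ rfl
      exact this
    exact key _ (List.map_id _)
  · simp [h a]

/-! ### Order-preserving compression of values -/

/-- The number of elements of `U` below `v`. -/
def countBelow (U : Finset ℕ) (v : ℕ) : ℕ := (U.filter (· < v)).card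

theorem countBelow_mono (U : Finset ℕ) : Monotone (countBelow U) := fun _ _ h =>
  Finset.card_le_card fun x hx => by
    simp only [Finset.mem_filter] at hx ⊢
    exact ⟨hx.1, hx.2.trans_le h⟩

/-- Strictness comes from `u` itself, which is counted below `v` but not below `u`. Only the smaller
number has to lie in `U`. -/
theorem countBelow_lt {U : Finset ℕ} {u v : ℕ} (hu : u ∈ U) (h : u < v) :
    countBelow U u < countBelow U v := by
  refine Finset.card_lt_card ((Finset.ssubset_iff_of_subset fun x hx => ?_).2 ⟨u, ?_, ?_⟩)
  · simp only [Finset.mem_filter] at hx ⊢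
    exact ⟨hx.1, hx.2.trans h⟩
  · simp [hu, h]
  · simp

theorem countBelow_le_card (U : Finset ℕ) (v : ℕ) : countBelow U v ≤ U.card :=
  Finset.card_filter_le _ _

theorem countBelow_zero (U : Finset ℕ) : countBelow U 0 = 0 := by simp [countBelow]

/-- Compression is exact on the weights `0` and `1`, where sums of weights will have to be compared.
-/
theorem countBelow_of_le_one {U : Finset ℕ} (h0 : 0 ∈ U) {v : ℕ} (hv : v ≤ 1) :
    countBelow U v = v := by
  interval_cases v
  · exact countBelow_zero U
  · have : U.filter (· < 1) = {0} := by
      ext x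
      simp only [Finset.mem_filter, Finset.mem_singleton, Nat.lt_one_iff]
      exact ⟨fun h => h.2, fun h => ⟨h ▸ h0, h⟩⟩
    rw [countBelow, this, Finset.card_singleton]

/-! ### Bounds on weights and ranks -/

section

variable {Ψ Sig Υ Q S : Type*} [Fintype Ψ] [Fintype Υ] {D : Transducer Ψ Sig Q}
  {B : DBW (Υ × Sig) S} {υ₀ : Υ} {w : Q → S → ℕ} {wt : Q → S → Ψ → Υ → ℕ} {d : Option Q → S → ℕ∞}

namespace IsWeightRanking

theorem wt_le (h : IsWeightRanking D B υ₀ w wt d) (q : Q) (s : S) (ψ : Ψ) (υ : Υ) :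
    wt q s ψ υ ≤ w q s :=
  (Finset.single_le_sum (f := fun ψ => wt q s ψ υ) (fun _ _ => Nat.zero_le _)
    (Finset.mem_univ ψ)).trans (h.weight_dir q s υ)

/-- Weights never increase along joint transitions: target `≤` transition `≤` source, starting from
`1`. -/
theorem weight_le_one (h : IsWeightRanking D B υ₀ w wt d) {q : Q} {s : S}
    (hr : JointReachable D B υ₀ q s) : w q s ≤ 1 := by
  induction hr with
  | init hs =>
    obtain ⟨s', hs', hw⟩ := h.weight_init
    rw [hs, Option.some_inj] at hs'
    exact hs' ▸ hw.le
  | step _ hq hs ih =>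
    exact (h.weight_target _ _ _ _ _ _ hq hs).trans ((h.wt_le _ _ _ _).trans ih)

/-- An order-preserving change of the ranks yields another ranking. -/
theorem map_rank (h : IsWeightRanking D B υ₀ w wt d) {d' : Option Q → S → ℕ∞}
    (htop : ∀ x s, d' x s ≠ ⊤ ↔ d x s ≠ ⊤)
    (hlt : ∀ x s y t, d x s < d y t → d y t ≠ ⊤ → d' x s < d' y t) :
    IsWeightRanking D B υ₀ w wt d' where
  weight_init := h.weight_init
  weight_real := h.weight_real
  weight_total := h.weight_total
  weight_dir := h.weight_dir
  weight_target := h.weight_target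
  rank_init := by simpa only [htop] using h.rank_init
  rank_trans q s υ hs hd ψ q' s' hw hq hs' :=
    hlt _ _ _ _ (h.rank_trans q s υ hs ((htop _ _).1 hd) ψ q' s' hw hq hs') ((htop _ _).1 hd)
  rank_free q s υ hs hd hw := by
    obtain ⟨σ, s', h1, h2⟩ := h.rank_free q s υ hs ((htop _ _).1 hd) hw
    exact ⟨σ, s', h1, hlt _ _ _ _ h2 ((htop _ _).1 hd)⟩
  rank_trans_buchi := by simpa only [htop] using h.rank_trans_buchi
  rank_free_buchi := by simpa only [htop] using h.rank_free_buchi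
  rank_bot s hs hd υ := by
    obtain ⟨σ, s', h1, h2⟩ := h.rank_bot s hs ((htop _ _).1 hd) υ
    exact ⟨σ, s', h1, hlt _ _ _ _ h2 ((htop _ _).1 hd)⟩
  rank_bot_buchi := by simpa only [htop] using h.rank_bot_buchi

theorem exists_bounded_rank [Fintype Q] [Fintype S] (h : IsWeightRanking D B υ₀ w wt d) :
    ∃ d' : Option Q → S → ℕ∞, IsWeightRanking D B υ₀ w wt d' ∧
      ∀ x s, d' x s ≠ ⊤ → d' x s ≤ ((Fintype.card (Option Q) * Fintype.card S : ℕ) : ℕ∞) := by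
  classical
  -- An infinite rank contributes `0` to `U`. This is harmless: all that counts is that `U` contains
  -- the finite ranks and has at most one element per argument of `d`.
  let U : Finset ℕ := Finset.univ.image fun y : Option Q × S => (d y.1 y.2).toNat
  have hU : ∀ x s, (d x s).toNat ∈ U := fun x s =>
    Finset.mem_image.2 ⟨(x, s), Finset.mem_univ _, rfl⟩
  let d' : Option Q → S → ℕ∞ := fun x s =>
    if d x s = ⊤ then ⊤ else (countBelow U (d x s).toNat : ℕ∞)
  refine ⟨d', h.map_rank (fun x s => ?_) (fun x s y t hlt ht => ?_), fun x s hx => ?_⟩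
  · by_cases hd : d x s = ⊤ <;> simp [d', hd]
  · have hs : d x s ≠ ⊤ := (hlt.trans_le le_top).ne
    have : (d x s).toNat < (d y t).toNat := by
      rw [← ENat.natCast_toNat hs, ← ENat.natCast_toNat ht] at hlt
      exact_mod_cast hlt
    simp only [d', hs, ht, if_false]
    exact_mod_cast countBelow_lt (hU x s) this
  · have hd : d x s ≠ ⊤ := by
      intro hd
      simp [d', hd] at hx
    simp only [d', hd, if_false]
    refine Nat.cast_le.2 ((countBelow_le_card _ _).trans (Finset.card_image_le.trans ?_))
    simp

end IsWeightRanking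

end

/-! ### Class rankings: weights up to order of magnitude -/

section

variable {Ψ Sig Υ Q S : Type*} [Fintype Ψ] {D : Transducer Ψ Sig Q} {B : DBW (Υ × Sig) S} {υ₀ : Υ}
  {c : Q → S → ℕ} {T : Q → S → Ψ → Υ → ℕ} {e : Option Q → S → ℕ}

/-- A discrete form of weight-rankings. The numbers `c` and `T` record the order of magnitude of the
weights, `0` standing for the weight `0` and `1` for the weight `1`; the rank `∞` is coded as `0`,
and the rank `r` as `r + 1`. -/
structure IsClassRanking (D : Transducer Ψ Sig Q) (B : DBW (Υ × Sig) S) (υ₀ : Υ)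
    (c : Q → S → ℕ) (T : Q → S → Ψ → Υ → ℕ) (d : Option Q → S → ℕ) : Prop where
  init : ∃ s, B.δ B.s₀ (υ₀, D.L D.q₀) = some s ∧ c D.q₀ s = 1 ∧ d (some D.q₀) s ≠ 0
  real : ∀ q s ψ υ, T q s ψ υ ≠ 0 →
    ∃ q' s', D.η q ψ = some q' ∧ B.δ s (υ, D.L q') = some s'
  le : ∀ q s ψ υ, T q s ψ υ ≤ c q s
  pair : ∀ q s υ ψ ψ', ψ ≠ ψ' → T q s ψ υ = 0 ∨ T q s ψ' υ = 0 ∨ T q s ψ υ < c q s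
  target : ∀ q s ψ υ q' s', D.η q ψ = some q' → B.δ s (υ, D.L q') = some s' →
    c q' s' ≤ T q s ψ υ
  le_one : ∀ q s, d (some q) s ≠ 0 → c q s ≤ 1
  trans : ∀ q s υ, d (some q) s ≠ 0 → ∀ ψ q' s', T q s ψ υ ≠ 0 → D.η q ψ = some q' →
    B.δ s (υ, D.L q') = some s' →
      d (some q') s' ≠ 0 ∧ (s ∉ B.F → d (some q') s' < d (some q) s)
  free : ∀ q s υ, d (some q) s ≠ 0 → ∑ ψ : Ψ, T q s ψ υ < c q s →
    ∃ σ s', B.δ s (υ, σ) = some s' ∧ d none s' ≠ 0 ∧ (s ∉ B.F → d none s' < d (some q) s)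
  bot : ∀ s, d none s ≠ 0 →
    ∀ υ, ∃ σ s', B.δ s (υ, σ) = some s' ∧ d none s' ≠ 0 ∧ (s ∉ B.F → d none s' < d none s)

/-- The weight of a given class: `0` for the class `0` and `K ^ j` for the class `j + 1`. -/
def classWeight (K : ℕ) : ℕ → ℕ
  | 0 => 0
  | j + 1 => K ^ j

theorem classWeight_mono {K : ℕ} (hK : 0 < K) : Monotone (classWeight K) := by
  rintro (_ | a) (_ | b) h
  · exact le_rfl
  · exact Nat.zero_le _
  · omega
  · exact Nat.pow_le_pow_right hK (by omega)

theorem classWeight_of_le_one (K : ℕ) {c : ℕ} (hc : c ≤ 1) : classWeight K c = c := by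
  interval_cases c <;> simp [classWeight]

theorem classWeight_eq_zero {K : ℕ} (hK : 0 < K) {c : ℕ} : classWeight K c = 0 ↔ c = 0 := by
  cases c <;> simp [classWeight, hK.ne']

/-- The rank coded by a number. -/
def codedRank (n : ℕ) : ℕ∞ := if n = 0 then ⊤ else n

theorem codedRank_ne_top {n : ℕ} : codedRank n ≠ ⊤ ↔ n ≠ 0 := by
  by_cases h : n = 0 <;> simp [codedRank, h]

theorem codedRank_lt {m n : ℕ} (hm : m ≠ 0) (h : m < n) : codedRank m < codedRank n := by
  have : n ≠ 0 := by omega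
  simpa [codedRank, hm, this] using h

/-- If some transition has the class of the pair, `pair` forces all others in this direction to `0`.
Otherwise each summand is at most `K ^ (j - 1)`, and there are fewer than `K = |Ψ| + 1` of them. -/
theorem IsClassRanking.sum_classWeight_le (h : IsClassRanking D B υ₀ c T e) (q : Q) (s : S)
    (υ : Υ) : ∑ ψ : Ψ, classWeight (Fintype.card Ψ + 1) (T q s ψ υ) ≤
      classWeight (Fintype.card Ψ + 1) (c q s) := by
  have hK : 0 < Fintype.card Ψ + 1 := Nat.succ_pos _
  generalize hc : c q s = n
  rcases n with _ | j
  · refine (Finset.sum_eq_zero fun ψ _ => ?_).le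
    have := h.le q s ψ υ
    rw [classWeight_eq_zero hK]
    omega
  · by_cases hex : ∃ ψ, T q s ψ υ = j + 1
    · obtain ⟨ψ, hψ⟩ := hex
      rw [Finset.sum_eq_single ψ, hψ]
      · intro ψ' _ hne
        rw [classWeight_eq_zero hK]
        rcases h.pair q s υ ψ ψ' hne.symm with h1 | h1 | h1 <;> omega
      · simp
    · push Not at hex
      -- Multiplying by `K` avoids the exponent `j - 1`, which is truncated at `j = 0`.
      have hle : ∀ ψ ∈ Finset.univ, classWeight (Fintype.card Ψ + 1) (T q s ψ υ) *
          (Fintype.card Ψ + 1) ≤ (Fintype.card Ψ + 1) ^ j := by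
        intro ψ _
        have h1 := h.le q s ψ υ
        have h2 := hex ψ
        generalize T q s ψ υ = t at *
        rcases t with _ | i
        · simp [classWeight]
        · rw [classWeight, ← pow_succ]
          exact Nat.pow_le_pow_right hK (by omega)
      have hsum := Finset.sum_le_card_nsmul _ _ _ hle
      rw [← Finset.sum_mul, Finset.card_univ, smul_eq_mul] at hsum
      rw [classWeight]
      refine Nat.le_of_mul_le_mul_right (hsum.trans ?_) hK
      rw [mul_comm]
      gcongr
      omega

variable [Fintype Υ] {w : Q → S → ℕ} {wt : Q → S → Ψ → Υ → ℕ} {d : Option Q → S → ℕ∞}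

/-- A finite rank forces the class to be at most `1`, where class and weight coincide. The test
whether a direction has unused weight is therefore the same for both. -/
theorem IsClassRanking.isWeightRanking (h : IsClassRanking D B υ₀ c T e) :
    IsWeightRanking D B υ₀ (fun q s => classWeight (Fintype.card Ψ + 1) (c q s))
      (fun q s ψ υ => classWeight (Fintype.card Ψ + 1) (T q s ψ υ))
      (fun x s => codedRank (e x s)) := by
  have hK : 0 < Fintype.card Ψ + 1 := Nat.succ_pos _
  have hpos : ∀ n, 0 < classWeight (Fintype.card Ψ + 1) n → n ≠ 0 := fun n hn h0 => by
    simp [h0, classWeight] at hn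
  have hfree : ∀ q s υ, e (some q) s ≠ 0 →
      ∑ ψ : Ψ, classWeight (Fintype.card Ψ + 1) (T q s ψ υ) <
        classWeight (Fintype.card Ψ + 1) (c q s) → ∑ ψ : Ψ, T q s ψ υ < c q s := by
    intro q s υ hd hlt
    have h1 := h.le_one q s hd
    rw [classWeight_of_le_one _ h1] at hlt
    refine lt_of_eq_of_lt (Finset.sum_congr rfl fun ψ _ => ?_) hlt
    rw [classWeight_of_le_one _ ((h.le q s ψ υ).trans h1)]
  obtain ⟨s₁, hs₁, hc₁, he₁⟩ := h.init
  refine ⟨⟨s₁, hs₁, by simp [hc₁, classWeight]⟩, fun q s ψ υ hw => h.real q s ψ υ (hpos _ hw),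
    fun q s => ?_, h.sum_classWeight_le,
    fun q s ψ υ q' s' h1 h2 => classWeight_mono hK (h.target q s ψ υ q' s' h1 h2),
    ⟨s₁, hs₁, codedRank_ne_top.2 he₁⟩, fun q s υ hs hd ψ q' s' hw h1 h2 => ?_,
    fun q s υ hs hd hw => ?_, fun q s υ hs hd ψ q' s' hw h1 h2 => ?_,
    fun q s υ hs hd hw => ?_, fun s hs hd υ => ?_, fun s hs hd υ => ?_⟩
  -- The bound on the total weight is the sum of the bounds for the single directions.
  · rw [Fintype.sum_prod_type_right]
    simpa using Finset.sum_le_card_nsmul Finset.univ _ _ fun υ _ => h.sum_classWeight_le q s υ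
  · obtain ⟨h3, h4⟩ := h.trans q s υ (codedRank_ne_top.1 hd) ψ q' s' (hpos _ hw) h1 h2
    exact codedRank_lt h3 (h4 hs)
  · obtain ⟨σ, s', h1, h2, h3⟩ := h.free q s υ (codedRank_ne_top.1 hd)
      (hfree q s υ (codedRank_ne_top.1 hd) hw)
    exact ⟨σ, s', h1, codedRank_lt h2 (h3 hs)⟩
  · exact codedRank_ne_top.2 (h.trans q s υ (codedRank_ne_top.1 hd) ψ q' s' (hpos _ hw) h1 h2).1
  · obtain ⟨σ, s', h1, h2, h3⟩ := h.free q s υ (codedRank_ne_top.1 hd)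
      (hfree q s υ (codedRank_ne_top.1 hd) hw)
    exact ⟨σ, s', h1, codedRank_ne_top.2 h2⟩
  · obtain ⟨σ, s', h1, h2, h3⟩ := h.bot s (codedRank_ne_top.1 hd) υ
    exact ⟨σ, s', h1, codedRank_lt h2 (h3 hs)⟩
  · obtain ⟨σ, s', h1, h2, h3⟩ := h.bot s (codedRank_ne_top.1 hd) υ
    exact ⟨σ, s', h1, codedRank_ne_top.2 h2⟩

/-- The code of a rank. -/
noncomputable def rankCode (r : ℕ∞) : ℕ := if r = ⊤ then 0 else r.toNat + 1

theorem rankCode_ne_zero {r : ℕ∞} : rankCode r ≠ 0 ↔ r ≠ ⊤ := by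
  by_cases h : r = ⊤ <;> simp [rankCode, h]

theorem rankCode_lt {r r' : ℕ∞} (h : r < r') (h' : r' ≠ ⊤) : rankCode r < rankCode r' := by
  have hr : r ≠ ⊤ := (h.trans_le le_top).ne
  simp only [rankCode, hr, h', if_false, Nat.add_lt_add_iff_right]
  rw [← ENat.natCast_toNat hr, ← ENat.natCast_toNat h'] at h
  exact_mod_cast h

theorem rankCode_le {r : ℕ∞} {n : ℕ} (h : r ≠ ⊤ → r ≤ n) : rankCode r ≤ n + 1 := by
  by_cases hr : r = ⊤
  · simp [rankCode, hr]
  · simp only [rankCode, hr, if_false, Nat.add_le_add_iff_right]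
    exact ENat.toNat_le_of_le_natCast (h hr)

-- Pairs of weight above `1` get rank `∞`, since classes cannot reproduce sums there. No rank
-- condition is lost: the initial pair has weight `1`, and positive transitions from pairs of weight
-- at most `1` lead only to such pairs.
open Classical in
theorem IsWeightRanking.isClassRanking (h : IsWeightRanking D B υ₀ w wt d) {U : Finset ℕ}
    (h0 : 0 ∈ U) (hwt : ∀ q s ψ υ, wt q s ψ υ ∈ U) :
    IsClassRanking D B υ₀ (fun q s => countBelow U (w q s))
      (fun q s ψ υ => countBelow U (wt q s ψ υ))
      (fun x s => if ∃ q, x = some q ∧ 1 < w q s then 0 else rankCode (d x s)) := by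
  have hpos : ∀ v, countBelow U v ≠ 0 → 0 < v := fun v hv => Nat.pos_of_ne_zero fun e => by
    simp [e, countBelow_zero] at hv
  have hd : ∀ q s, (if ∃ q', some q = some q' ∧ 1 < w q' s then 0 else rankCode (d (some q) s)) ≠ 0
      → w q s ≤ 1 ∧ d (some q) s ≠ ⊤ := by
    intro q s hne
    by_cases hw : 1 < w q s
    · simp [hw] at hne
    · exact ⟨by omega, rankCode_ne_zero.1 (by simpa [hw] using hne)⟩
  have hd' : ∀ q s, w q s ≤ 1 →
      (if ∃ q', some q = some q' ∧ 1 < w q' s then 0 else rankCode (d (some q) s)) =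
        rankCode (d (some q) s) := by
    intro q s hw
    simp [hw]
  obtain ⟨s₁, hs₁, hw₁⟩ := h.weight_init
  obtain ⟨s₂, hs₂, hr₁⟩ := h.rank_init
  obtain rfl : s₁ = s₂ := by simpa [hs₁] using hs₂
  refine ⟨⟨s₁, hs₁, ?_, ?_⟩, fun q s ψ υ hw => h.weight_real q s ψ υ (hpos _ hw),
    fun q s ψ υ => countBelow_mono U (h.wt_le q s ψ υ), fun q s υ ψ ψ' hne => ?_,
    fun q s ψ υ q' s' h1 h2 => countBelow_mono U (h.weight_target q s ψ υ q' s' h1 h2),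
    fun q s hq => ?_, fun q s υ hq ψ q' s' hw h1 h2 => ?_, fun q s υ hq hlt => ?_,
    fun s hs υ => ?_⟩
  · rw [hw₁, countBelow_of_le_one h0 le_rfl]
  · rw [hd' _ _ hw₁.le]
    exact rankCode_ne_zero.2 hr₁
  -- Two positive weights with sum at most `w q s` are both strictly smaller than it, and
  -- `countBelow_lt` carries this over to the classes.
  · by_contra! hcon
    have h1 := hpos _ hcon.1
    have h2 := hpos _ hcon.2.1
    have h3 : wt q s ψ υ + wt q s ψ' υ ≤ w q s := by
      refine le_trans ?_ (h.weight_dir q s υ)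
      rw [← Finset.sum_pair (f := fun ψ => wt q s ψ υ) hne]
      exact Finset.sum_le_sum_of_subset (Finset.subset_univ _)
    exact absurd (countBelow_lt (hwt q s ψ υ) (by omega : _ < w q s)) (not_lt.2 hcon.2.2)
  · have := (hd q s hq).1
    rwa [countBelow_of_le_one h0 this]
  · obtain ⟨hw1, hdt⟩ := hd q s hq
    have hw' : w q' s' ≤ 1 :=
      (h.weight_target q s ψ υ q' s' h1 h2).trans ((h.wt_le q s ψ υ).trans hw1)
    rw [hd' _ _ hw', hd' _ _ hw1]
    refine ⟨rankCode_ne_zero.2 ?_, fun hs =>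
      rankCode_lt (h.rank_trans q s υ hs hdt ψ q' s' (hpos _ hw) h1 h2) hdt⟩
    by_cases hs : s ∈ B.F
    · exact h.rank_trans_buchi q s υ hs hdt ψ q' s' (hpos _ hw) h1 h2
    · exact ((h.rank_trans q s υ hs hdt ψ q' s' (hpos _ hw) h1 h2).trans_le le_top).ne
  · obtain ⟨hw1, hdt⟩ := hd q s hq
    have hlt' : ∑ ψ : Ψ, wt q s ψ υ < w q s := by
      rw [countBelow_of_le_one h0 hw1] at hlt
      refine lt_of_eq_of_lt (Finset.sum_congr rfl fun ψ _ => ?_) hlt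
      rw [countBelow_of_le_one h0 ((h.wt_le q s ψ υ).trans hw1)]
    rw [hd' _ _ hw1]
    by_cases hs : s ∈ B.F
    · obtain ⟨σ, s', h1, h2⟩ := h.rank_free_buchi q s υ hs hdt hlt'
      exact ⟨σ, s', h1, by simpa using rankCode_ne_zero.2 h2, fun hs' => absurd hs hs'⟩
    · obtain ⟨σ, s', h1, h2⟩ := h.rank_free q s υ hs hdt hlt'
      exact ⟨σ, s', h1, by simpa using rankCode_ne_zero.2 (h2.trans_le le_top).ne,
        fun _ => by simpa using rankCode_lt h2 hdt⟩
  · have hdt : d none s ≠ ⊤ := rankCode_ne_zero.1 (by simpa using hs)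
    by_cases hs : s ∈ B.F
    · obtain ⟨σ, s', h1, h2⟩ := h.rank_bot_buchi s hs hdt υ
      exact ⟨σ, s', h1, by simpa using rankCode_ne_zero.2 h2, fun hs' => absurd hs hs'⟩
    · obtain ⟨σ, s', h1, h2⟩ := h.rank_bot s hs hdt υ
      exact ⟨σ, s', h1, by simpa using rankCode_ne_zero.2 (h2.trans_le le_top).ne,
        fun _ => by simpa using rankCode_lt h2 hdt⟩

/-- A weight-ranking exists if and only if a class ranking with small entries exists. -/
theorem exists_isWeightRanking_iff [Fintype Q] [Fintype S] :
    (∃ w wt d, IsWeightRanking D B υ₀ w wt d) ↔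
      ∃ (c : Q → S → ℕ) (T : Q → S → Ψ → Υ → ℕ) (e : Option Q → S → ℕ),
        IsClassRanking D B υ₀ c T e ∧
        (∀ q s, c q s ≤ Fintype.card (Q × S × Ψ × Υ) + 1) ∧
        (∀ q s ψ υ, T q s ψ υ ≤ Fintype.card (Q × S × Ψ × Υ) + 1) ∧
        ∀ x s, e x s ≤ Fintype.card (Option Q) * Fintype.card S + 1 := by
  classical
  constructor
  · rintro ⟨w, wt, d₀, h₀⟩
    obtain ⟨d, h, hd⟩ := h₀.exists_bounded_rank
    -- Weights of pairs may stay outside `U`: strict comparisons only have transition weights on the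
    -- smaller side.
    let U : Finset ℕ :=
      insert 0 (Finset.univ.image fun y : Q × S × Ψ × Υ => wt y.1 y.2.1 y.2.2.1 y.2.2.2)
    have hU : U.card ≤ Fintype.card (Q × S × Ψ × Υ) + 1 :=
      (Finset.card_insert_le _ _).trans (Nat.add_le_add_right Finset.card_image_le _)
    refine ⟨_, _, _, h.isClassRanking (U := U) (Finset.mem_insert_self _ _) (fun q s ψ υ =>
      Finset.mem_insert_of_mem (Finset.mem_image.2 ⟨(q, s, ψ, υ), Finset.mem_univ _, rfl⟩)),
      fun q s => (countBelow_le_card _ _).trans hU,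
      fun q s ψ υ => (countBelow_le_card _ _).trans hU, fun x s => ?_⟩
    split_ifs
    · exact Nat.zero_le _
    · exact rankCode_le fun hx => hd x s hx
  · rintro ⟨c, T, e, h, -⟩
    exact ⟨_, _, _, h.isWeightRanking⟩

end

/-! ### Class rankings as tables of numbers -/

/-- The numbers that make up an instance together with a class ranking. Partial functions are coded
as in `optCode`, and the row `nQ` of `d` is that of `q^⊥`. -/
structure Tables where
  nΨ : ℕ
  nSig : ℕ
  nΥ : ℕ
  nQ : ℕ
  nS : ℕ
  q₀ : ℕ
  s₀ : ℕ
  υ₀ : ℕ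
  L : ℕ → ℕ
  η : ℕ → ℕ → ℕ
  F : ℕ → ℕ
  δ : ℕ → ℕ → ℕ → ℕ
  c : ℕ → ℕ → ℕ
  T : ℕ → ℕ → ℕ → ℕ → ℕ
  d : ℕ → ℕ → ℕ

namespace Tables

/-- The state of the transducer after `ψ`. -/
def nextQ (t : Tables) (q ψ : ℕ) : ℕ := t.η q ψ - 1

/-- The code of the state of the automaton after a joint transition. -/
def joint (t : Tables) (q s ψ υ : ℕ) : ℕ := t.δ s υ (t.L (t.nextQ q ψ))

/-- The automaton can move from `s` in direction `υ` such that the rank of `q^⊥` drops below `r`. -/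
def Free (t : Tables) (s υ r : ℕ) : Prop :=
  ∃ σ < t.nSig, t.δ s υ σ ≠ 0 ∧ t.d t.nQ (t.δ s υ σ - 1) ≠ 0 ∧
    (t.F s = 0 → t.d t.nQ (t.δ s υ σ - 1) < r)

/-- The conditions that involve a single quadruple. -/
def ValidAt (t : Tables) (q s ψ υ : ℕ) : Prop :=
  (t.T q s ψ υ ≠ 0 → t.η q ψ ≠ 0 ∧ t.joint q s ψ υ ≠ 0) ∧
  (t.η q ψ ≠ 0 → t.joint q s ψ υ ≠ 0 →
    t.c (t.nextQ q ψ) (t.joint q s ψ υ - 1) ≤ t.T q s ψ υ) ∧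
  t.T q s ψ υ ≤ t.c q s ∧
  (∀ ψ' < t.nΨ, ψ ≠ ψ' → t.T q s ψ υ = 0 ∨ t.T q s ψ' υ = 0 ∨ t.T q s ψ υ < t.c q s) ∧
  (t.d q s ≠ 0 → t.T q s ψ υ ≠ 0 → t.η q ψ ≠ 0 → t.joint q s ψ υ ≠ 0 →
    t.d (t.nextQ q ψ) (t.joint q s ψ υ - 1) ≠ 0 ∧
      (t.F s = 0 → t.d (t.nextQ q ψ) (t.joint q s ψ υ - 1) < t.d q s))

/-- The tables contain a class ranking of the instance. -/
def Valid (t : Tables) : Prop :=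
  (t.δ t.s₀ t.υ₀ (t.L t.q₀) ≠ 0 ∧ t.c t.q₀ (t.δ t.s₀ t.υ₀ (t.L t.q₀) - 1) = 1 ∧
    t.d t.q₀ (t.δ t.s₀ t.υ₀ (t.L t.q₀) - 1) ≠ 0) ∧
  (∀ q < t.nQ, ∀ s < t.nS, ∀ ψ < t.nΨ, ∀ υ < t.nΥ, t.ValidAt q s ψ υ) ∧
  (∀ q < t.nQ, ∀ s < t.nS, t.d q s ≠ 0 → t.c q s ≤ 1) ∧
  (∀ q < t.nQ, ∀ s < t.nS, ∀ υ < t.nΥ, t.d q s ≠ 0 →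
    ∑ ψ ∈ Finset.range t.nΨ, t.T q s ψ υ < t.c q s → t.Free s υ (t.d q s)) ∧
  ∀ s < t.nS, ∀ υ < t.nΥ, t.d t.nQ s ≠ 0 → t.Free s υ (t.d t.nQ s)

/-- The tables agree with those of a given instance. -/
structure Represents (t : Tables) (I : Instance) : Prop where
  nΨ : t.nΨ = I.nΨ
  nSig : t.nSig = I.nSig
  nΥ : t.nΥ = I.nΥ
  nQ : t.nQ = I.nQ
  nS : t.nS = I.nS
  q₀ : t.q₀ = I.D.q₀
  s₀ : t.s₀ = I.B.s₀
  υ₀ : t.υ₀ = I.υ₀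
  L : ∀ q : Fin I.nQ, t.L q = I.D.L q
  η : ∀ (q : Fin I.nQ) (ψ : Fin I.nΨ), t.η q ψ = optCode (I.D.η q ψ)
  F : ∀ s : Fin I.nS, t.F s = if s ∈ I.B.F then 1 else 0
  δ : ∀ (s : Fin I.nS) (υ : Fin I.nΥ) (σ : Fin I.nSig), t.δ s υ σ = optCode (I.B.δ s (υ, σ))

theorem optCode_some {n : ℕ} (i : Fin n) : optCode (some i) - 1 = i := rfl

theorem optCode_ne_zero {n : ℕ} {o : Option (Fin n)} : optCode o ≠ 0 ↔ ∃ i, o = some i := by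
  cases o <;> simp [optCode]

/-- The row of the table of ranks that belongs to a state or to `q^⊥`. -/
def row {n : ℕ} (x : Option (Fin n)) : ℕ := x.elim n fun q => q

theorem Represents.free_iff {t : Tables} {I : Instance} (h : t.Represents I) (s : Fin I.nS)
    (υ : Fin I.nΥ) (r : ℕ) : t.Free s υ r ↔
      ∃ σ s', I.B.δ s (υ, σ) = some s' ∧ t.d (row (none : Option (Fin I.nQ))) s' ≠ 0 ∧
        (s ∉ I.B.F → t.d (row (none : Option (Fin I.nQ))) s' < r) := by
  have hF : t.F s = 0 ↔ s ∉ I.B.F := by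
    rw [h.F]
    split_ifs <;> simp [*]
  simp only [Free, h.nSig, h.nQ, hF, row, Option.elim_none]
  constructor
  · rintro ⟨σ, hσ, h1, h2⟩
    rw [h.δ s υ ⟨σ, hσ⟩] at h1 h2
    obtain ⟨s', hs'⟩ := optCode_ne_zero.1 h1
    rw [hs', optCode_some] at h2
    exact ⟨⟨σ, hσ⟩, s', hs', h2⟩
  · rintro ⟨σ, s', hs', h2⟩
    refine ⟨σ, σ.2, ?_⟩
    rw [h.δ, hs', optCode_some]
    exact ⟨by simp [optCode], h2⟩

theorem Represents.joint_eq {t : Tables} {I : Instance} (h : t.Represents I) {q q' : Fin I.nQ}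
    {ψ : Fin I.nΨ} (hq : I.D.η q ψ = some q') (s : Fin I.nS) (υ : Fin I.nΥ) :
    t.nextQ q ψ = q' ∧ t.joint q s ψ υ = optCode (I.B.δ s (υ, I.D.L q')) := by
  have : t.nextQ q ψ = q' := by rw [nextQ, h.η, hq, optCode_some]
  exact ⟨this, by rw [joint, this, h.L, h.δ]⟩

/-- Entries are consulted only where they are meaningful. Where `η` is undefined, `nextQ` and
`joint` are junk, but each condition using them is guarded by or paired with definedness of `η`. -/
theorem Represents.valid_iff {t : Tables} {I : Instance} (h : t.Represents I) :
    t.Valid ↔ IsClassRanking I.D I.B I.υ₀ (fun q s => t.c q s) (fun q s ψ υ => t.T q s ψ υ)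
      (fun x s => t.d (row x) s) := by
  have hF : ∀ s : Fin I.nS, t.F s = 0 ↔ s ∉ I.B.F := fun s => by
    rw [h.F]
    split_ifs <;> simp [*]
  have hδ₀ : t.δ t.s₀ t.υ₀ (t.L t.q₀) = optCode (I.B.δ I.B.s₀ (I.υ₀, I.D.L I.D.q₀)) := by
    rw [h.q₀, h.L, h.s₀, h.υ₀, h.δ]
  constructor
  · rintro ⟨⟨h1, h2, h3⟩, hat, hone, hfree, hbot⟩
    rw [h.nQ, h.nS, h.nΨ, h.nΥ] at hat
    rw [h.nQ, h.nS] at hone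
    rw [h.nQ, h.nS, h.nΥ] at hfree
    rw [h.nS, h.nΥ, h.nQ] at hbot
    rw [hδ₀] at h1 h2 h3
    obtain ⟨s, hs⟩ := optCode_ne_zero.1 h1
    rw [hs, optCode_some, h.q₀] at h2 h3
    refine ⟨⟨s, hs, h2, h3⟩, fun q s ψ υ hT => ?_, fun q s ψ υ => ?_, fun q s υ ψ ψ' hne => ?_,
      fun q s ψ υ q' s' hq hs' => ?_, fun q s => hone q q.2 s s.2,
      fun q s υ hd ψ q' s' hT hq hs' => ?_, fun q s υ hd hT => ?_, fun s hd υ => ?_⟩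
    · obtain ⟨h4, h5⟩ := (hat q q.2 s s.2 ψ ψ.2 υ υ.2).1 hT
      rw [h.η] at h4
      obtain ⟨q', hq'⟩ := optCode_ne_zero.1 h4
      rw [(h.joint_eq hq' s υ).2] at h5
      obtain ⟨s', hs'⟩ := optCode_ne_zero.1 h5
      exact ⟨q', s', hq', hs'⟩
    · exact (hat q q.2 s s.2 ψ ψ.2 υ υ.2).2.2.1
    · exact (hat q q.2 s s.2 ψ ψ.2 υ υ.2).2.2.2.1 ψ' (ψ'.2.trans_eq h.nΨ.symm)
        (by simpa [Fin.ext_iff] using hne)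
    · have h4 := (hat q q.2 s s.2 ψ ψ.2 υ υ.2).2.1
      obtain ⟨e1, e2⟩ := h.joint_eq hq s υ
      rw [h.η, e1, e2, hq, hs', optCode_some] at h4
      exact h4 (by simp [optCode]) (by simp [optCode])
    · have h4 := (hat q q.2 s s.2 ψ ψ.2 υ υ.2).2.2.2.2
      obtain ⟨e1, e2⟩ := h.joint_eq hq s υ
      rw [h.η, e1, e2, hq, hs', optCode_some, hF] at h4
      exact h4 hd hT (by simp [optCode]) (by simp [optCode])
    · refine (h.free_iff s υ _).1 (hfree q q.2 s s.2 υ υ.2 hd ?_)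
      rw [h.nΨ, Finset.sum_range]
      exact hT
    · exact (h.free_iff s υ _).1 (hbot s s.2 υ υ.2 hd)
  · rintro ⟨⟨s₁, hs₁, hc₁, hd₁⟩, hreal, hle, hpair, htarget, hone, htrans, hfree, hbot⟩
    refine ⟨?_, ?_, ?_, ?_, ?_⟩
    · rw [hδ₀, hs₁, optCode_some, h.q₀]
      exact ⟨by simp [optCode], hc₁, hd₁⟩
    · rw [h.nQ, h.nS, h.nΨ, h.nΥ]
      intro q hq s hs ψ hψ υ hυ
      lift q to Fin I.nQ using hq
      lift s to Fin I.nS using hs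
      lift ψ to Fin I.nΨ using hψ
      lift υ to Fin I.nΥ using hυ
      refine ⟨fun hT => ?_, fun h1 h2 => ?_, hle q s ψ υ, fun ψ' hψ' hne => ?_,
        fun hd hT h1 h2 => ?_⟩
      · obtain ⟨q', s', hq', hs'⟩ := hreal q s ψ υ hT
        rw [(h.joint_eq hq' s υ).2, h.η, hq', hs']
        simp [optCode]
      · rw [h.η] at h1
        obtain ⟨q', hq'⟩ := optCode_ne_zero.1 h1
        obtain ⟨e1, e2⟩ := h.joint_eq hq' s υ
        rw [e2] at h2
        obtain ⟨s', hs'⟩ := optCode_ne_zero.1 h2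
        rw [e1, e2, hs', optCode_some]
        exact htarget q s ψ υ q' s' hq' hs'
      · rw [h.nΨ] at hψ'
        exact hpair q s υ ψ ⟨ψ', hψ'⟩ (by simpa [Fin.ext_iff] using hne)
      · rw [h.η] at h1
        obtain ⟨q', hq'⟩ := optCode_ne_zero.1 h1
        obtain ⟨e1, e2⟩ := h.joint_eq hq' s υ
        rw [e2] at h2
        obtain ⟨s', hs'⟩ := optCode_ne_zero.1 h2
        rw [e1, e2, hs', optCode_some, hF]
        exact htrans q s υ hd ψ q' s' hT hq' hs'
    · rw [h.nQ, h.nS]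
      exact fun q hq s hs => hone ⟨q, hq⟩ ⟨s, hs⟩
    · rw [h.nQ, h.nS, h.nΥ, h.nΨ]
      intro q hq s hs υ hυ hd hT
      rw [Finset.sum_range] at hT
      exact (h.free_iff ⟨s, hs⟩ ⟨υ, hυ⟩ _).2 (hfree ⟨q, hq⟩ ⟨s, hs⟩ ⟨υ, hυ⟩ hd hT)
    · rw [h.nQ, h.nS, h.nΥ]
      intro s hs υ hυ hd
      exact (h.free_iff ⟨s, hs⟩ ⟨υ, hυ⟩ _).2 (hbot ⟨s, hs⟩ hd ⟨υ, hυ⟩)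

/-- The tables contained in a sequence of numbers: an instance followed by the entries of a class
ranking. -/
def ofSeq (g : ℕ → ℕ) : Tables where
  nΨ := g 0
  nSig := g 1
  nΥ := g 2
  nQ := g 3
  nS := g 4
  q₀ := g 5
  s₀ := g 6
  υ₀ := g 7
  L q := g (8 + (q * 2 + 1))
  η q ψ := g (8 + (g 3 * 2 + (q * (g 0 * 3) + (ψ * 3 + 2))))
  F s := g (8 + (g 3 * 2 + (g 3 * (g 0 * 3) + (s * 2 + 1))))
  δ s υ σ := g (8 + (g 3 * 2 + (g 3 * (g 0 * 3) + (g 4 * 2 +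
    (s * (g 2 * (g 1 * 4)) + (υ * (g 1 * 4) + (σ * 4 + 3)))))))
  c q s := g (8 + (g 3 * 2 + (g 3 * (g 0 * 3) + (g 4 * 2 + (g 4 * (g 2 * (g 1 * 4)) +
    (q * g 4 + s))))))
  T q s ψ υ := g (8 + (g 3 * 2 + (g 3 * (g 0 * 3) + (g 4 * 2 + (g 4 * (g 2 * (g 1 * 4)) +
    (g 3 * g 4 + (q * (g 4 * (g 0 * g 2)) + (s * (g 0 * g 2) + (ψ * g 2 + υ)))))))))
  d x s := g (8 + (g 3 * 2 + (g 3 * (g 0 * 3) + (g 4 * 2 + (g 4 * (g 2 * (g 1 * 4)) +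
    (g 3 * g 4 + (g 3 * (g 4 * (g 0 * g 2)) + (x * g 4 + s))))))))

end Tables

/-! ### Validity as a term of bounded arithmetic -/

namespace Term

open Prog (blockLength)

instance : Add Term := ⟨add⟩

instance : Mul Term := ⟨mul⟩

instance : Sub Term := ⟨sub⟩

instance (n : ℕ) : OfNat Term n := ⟨const n⟩

/-- Truth of a term, read as a formula. -/
def Holds (A : List Bool) (ρ : ℕ → ℕ) (t : Term) : Prop := t.eval A ρ ≠ 0

/-- The formula `a = 0`. -/
def isZero (a : Term) : Term := 1 - a

/-- Conjunction. -/
def and (a b : Term) : Term := a * b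

/-- Disjunction. -/
def or (a b : Term) : Term := a + b

/-- Implication. -/
def imp (a b : Term) : Term := or (isZero a) b

/-- The formula `a < b`. -/
def lt (a b : Term) : Term := b - a

/-- The formula `a ≤ b`. -/
def le (a b : Term) : Term := isZero (lt b a)

/-- The formula `a = b`. -/
def eq (a b : Term) : Term := and (le a b) (le b a)

/-- Bounded universal quantification. -/
def all (x : ℕ) (b t : Term) : Term := isZero (sum x b (isZero t))

section

variable {A : List Bool} {ρ : ℕ → ℕ} {a b t : Term}

theorem holds_isZero : (isZero a).Holds A ρ ↔ a.eval A ρ = 0 := by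
  change 1 - a.eval A ρ ≠ 0 ↔ _
  omega

theorem holds_and : (and a b).Holds A ρ ↔ a.Holds A ρ ∧ b.Holds A ρ := by
  change a.eval A ρ * b.eval A ρ ≠ 0 ↔ _
  exact mul_ne_zero_iff

theorem holds_or : (or a b).Holds A ρ ↔ a.Holds A ρ ∨ b.Holds A ρ := by
  change a.eval A ρ + b.eval A ρ ≠ 0 ↔ a.eval A ρ ≠ 0 ∨ b.eval A ρ ≠ 0
  omega

theorem holds_imp : (imp a b).Holds A ρ ↔ (a.Holds A ρ → b.Holds A ρ) := by
  rw [imp, holds_or, holds_isZero, Holds]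
  tauto

theorem holds_lt : (lt a b).Holds A ρ ↔ a.eval A ρ < b.eval A ρ := by
  change b.eval A ρ - a.eval A ρ ≠ 0 ↔ _
  omega

theorem holds_le : (le a b).Holds A ρ ↔ a.eval A ρ ≤ b.eval A ρ := by
  rw [le, holds_isZero]
  have := holds_lt (A := A) (ρ := ρ) (a := b) (b := a)
  unfold Holds at this
  omega

theorem holds_eq : (eq a b).Holds A ρ ↔ a.eval A ρ = b.eval A ρ := by
  rw [eq, holds_and, holds_le, holds_le, le_antisymm_iff]

theorem eval_eq_eq_zero : (eq a b).eval A ρ = 0 ↔ a.eval A ρ ≠ b.eval A ρ := by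
  rw [← not_iff_not, not_not]
  exact holds_eq

/-- A sum of natural numbers is nonzero iff a summand is, so `sum` doubles as a bounded existential
quantifier. -/
theorem holds_sum {x : ℕ} :
    (sum x b t).Holds A ρ ↔ ∃ i < b.eval A ρ, t.Holds A (Function.update ρ x i) := by
  simp [Holds, eval, Finset.sum_eq_zero_iff]

theorem holds_all {x : ℕ} :
    (all x b t).Holds A ρ ↔ ∀ i < b.eval A ρ, t.Holds A (Function.update ρ x i) := by
  rw [all, holds_isZero, ← not_iff_not]
  refine (holds_sum (t := isZero t)).trans ?_
  simp only [holds_isZero]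
  simp only [Holds]
  push Not
  rfl

end

/-- The numbers written in the word. -/
def readSeq (A : List Bool) (i : ℕ) : ℕ := blockLength A (i + 1)

/-- The term for the `n`-th number of the word. -/
def num (n : ℕ) : Term := get (const n)

/-- The term for the output labelling. -/
def tL (q : Term) : Term := get (8 + (q * 2 + 1))

/-- The term for the transition function of the transducer. -/
def tη (q ψ : Term) : Term := get (8 + (num 3 * 2 + (q * (num 0 * 3) + (ψ * 3 + 2))))

/-- The term for the set of Büchi states. -/
def tF (s : Term) : Term := get (8 + (num 3 * 2 + (num 3 * (num 0 * 3) + (s * 2 + 1))))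

/-- The term for the transition function of the automaton. -/
def tδ (s υ σ : Term) : Term := get (8 + (num 3 * 2 + (num 3 * (num 0 * 3) + (num 4 * 2 +
  (s * (num 2 * (num 1 * 4)) + (υ * (num 1 * 4) + (σ * 4 + 3)))))))

/-- The term for the classes of the pairs. -/
def tc (q s : Term) : Term := get (8 + (num 3 * 2 + (num 3 * (num 0 * 3) + (num 4 * 2 +
  (num 4 * (num 2 * (num 1 * 4)) + (q * num 4 + s))))))

/-- The term for the classes of the transitions. -/
def tT (q s ψ υ : Term) : Term := get (8 + (num 3 * 2 + (num 3 * (num 0 * 3) + (num 4 * 2 +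
  (num 4 * (num 2 * (num 1 * 4)) + (num 3 * num 4 + (q * (num 4 * (num 0 * num 2)) +
    (s * (num 0 * num 2) + (ψ * num 2 + υ)))))))))

/-- The term for the codes of the ranks. -/
def td (x s : Term) : Term := get (8 + (num 3 * 2 + (num 3 * (num 0 * 3) + (num 4 * 2 +
  (num 4 * (num 2 * (num 1 * 4)) + (num 3 * num 4 + (num 3 * (num 4 * (num 0 * num 2)) +
    (x * num 4 + s))))))))

/-- The term for `Tables.joint`. -/
def tJoint (q s ψ υ : Term) : Term := tδ s υ (tL (tη q ψ - 1))

/-- The formula `Tables.Free`, with the bound variable `5`. -/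
def freeTerm (s υ r : Term) : Term :=
  sum 5 (num 1) (and (tδ s υ (var 5)) (and (td (num 3) (tδ s υ (var 5) - 1))
    (imp (isZero (tF s)) (lt (td (num 3) (tδ s υ (var 5) - 1)) r))))

/-- The formula `Tables.ValidAt`, with the bound variable `4`. -/
def validAtTerm (q s ψ υ : Term) : Term :=
  and (imp (tT q s ψ υ) (and (tη q ψ) (tJoint q s ψ υ)))
  (and (imp (tη q ψ) (imp (tJoint q s ψ υ) (le (tc (tη q ψ - 1) (tJoint q s ψ υ - 1)) (tT q s ψ υ))))
  (and (le (tT q s ψ υ) (tc q s))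
  (and (all 4 (num 0) (imp (isZero (eq ψ (var 4))) (or (isZero (tT q s ψ υ))
    (or (isZero (tT q s (var 4) υ)) (lt (tT q s ψ υ) (tc q s))))))
  (imp (td q s) (imp (tT q s ψ υ) (imp (tη q ψ) (imp (tJoint q s ψ υ)
    (and (td (tη q ψ - 1) (tJoint q s ψ υ - 1))
      (imp (isZero (tF s)) (lt (td (tη q ψ - 1) (tJoint q s ψ υ - 1)) (td q s)))))))))))

/-- The formula `Tables.Valid`. -/
def validTerm : Term :=
  and (and (tδ (num 6) (num 7) (tL (num 5)))
    (and (eq (tc (num 5) (tδ (num 6) (num 7) (tL (num 5)) - 1)) 1)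
      (td (num 5) (tδ (num 6) (num 7) (tL (num 5)) - 1))))
  (and (all 0 (num 3) (all 1 (num 4) (all 2 (num 0) (all 3 (num 2)
    (validAtTerm (var 0) (var 1) (var 2) (var 3))))))
  (and (all 0 (num 3) (all 1 (num 4) (imp (td (var 0) (var 1)) (le (tc (var 0) (var 1)) 1))))
  (and (all 0 (num 3) (all 1 (num 4) (all 3 (num 2) (imp (td (var 0) (var 1))
    (imp (lt (sum 2 (num 0) (tT (var 0) (var 1) (var 2) (var 3))) (tc (var 0) (var 1)))
      (freeTerm (var 1) (var 3) (td (var 0) (var 1))))))))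
  (all 1 (num 4) (all 3 (num 2) (imp (td (num 3) (var 1))
    (freeTerm (var 1) (var 3) (td (num 3) (var 1)))))))))

section

variable {A : List Bool} {ρ : ℕ → ℕ}

/-- The hypothesis on `r` prevents capture of the bound variable `5`. Once the connectives are
unfolded, both sides agree by `rfl`, as the terms copy the index arithmetic of `Tables.ofSeq`. -/
theorem holds_freeTerm (r : Term) (hr : r.vars ≤ 5) : (freeTerm (var 1) (var 3) r).Holds A ρ ↔
    (Tables.ofSeq (readSeq A)).Free (ρ 1) (ρ 3) (r.eval A ρ) := by
  have hr' : ∀ i, r.eval A (Function.update ρ 5 i) = r.eval A ρ := fun i =>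
    eval_congr A r hr fun j hj => by rw [Function.update_of_ne (by omega)]
  simp only [freeTerm, holds_sum, holds_and, holds_imp, holds_isZero, holds_lt, hr']
  rfl

theorem holds_validAtTerm : (validAtTerm (var 0) (var 1) (var 2) (var 3)).Holds A ρ ↔
    (Tables.ofSeq (readSeq A)).ValidAt (ρ 0) (ρ 1) (ρ 2) (ρ 3) := by
  simp only [validAtTerm, holds_and, holds_or, holds_imp, holds_isZero, holds_lt, holds_le,
    holds_all, eval_eq_eq_zero]
  rfl

theorem holds_validTerm : validTerm.Holds A ρ ↔ (Tables.ofSeq (readSeq A)).Valid := by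
  simp only [validTerm, holds_and, holds_imp, holds_lt, holds_le, holds_eq, holds_all,
    holds_validAtTerm, holds_freeTerm (td (var 0) (var 1)) (by decide),
    holds_freeTerm (td (num 3) (var 1)) (by decide)]
  rfl

end

end Term

/-! ### Positions of table entries in the encoding -/

theorem length_natsToBits_le {l : List ℕ} {M : ℕ} (h : ∀ n ∈ l, n ≤ M) :
    (natsToBits l).length ≤ l.length * (M + 1) := by
  induction l with
  | nil => simp [natsToBits]
  | cons n l ih =>
    have h1 := ih fun m hm => h m (List.mem_cons_of_mem _ hm)
    have h2 := h n List.mem_cons_self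
    simp only [natsToBits, List.flatMap_cons, List.length_append, List.length_replicate,
      List.length_cons, List.length_nil] at h1 ⊢
    linarith

theorem le_length_natsToBits {l : List ℕ} {n : ℕ} (h : n ∈ l) : n ≤ (natsToBits l).length := by
  induction l with
  | nil => simp at h
  | cons m l ih =>
    simp only [natsToBits, List.flatMap_cons, List.length_append, List.length_replicate,
      List.length_cons, List.length_nil] at ih ⊢
    rcases List.mem_cons.1 h with rfl | h
    · omega
    · have := ih h
      omega

theorem natsToBits_append (l l' : List ℕ) :
    natsToBits (l ++ l') = natsToBits l ++ natsToBits l' := List.flatMap_append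

theorem readSeq_of_getElem? {l : List ℕ} {i v : ℕ} (h : l[i]? = some v) (A : List Bool) :
    Term.readSeq (natsToBits l ++ A) i = v := by
  obtain ⟨hi, hv⟩ := List.getElem?_eq_some_iff.1 h
  rw [Term.readSeq, Prog.blockLength_natsToBits, dif_pos hi, hv]

theorem getElem?_append_add {α : Type*} {l₁ l₂ : List α} {n : ℕ} (h : l₁.length = n) (i : ℕ) :
    (l₁ ++ l₂)[n + i]? = l₂[i]? := by
  subst h
  simp [List.getElem?_append_right]

theorem getElem?_append_of_some {α : Type*} {l₁ l₂ : List α} {i : ℕ} {v : α}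
    (h : l₁[i]? = some v) : (l₁ ++ l₂)[i]? = some v := by
  obtain ⟨hi, -⟩ := List.getElem?_eq_some_iff.1 h
  rw [List.getElem?_append_left hi, h]

/-- Row-major indexing for rows of equal length `k`; iterating it handles tables with several
arguments. -/
theorem getElem?_flatMap {α β : Type*} {f : α → List β} {k : ℕ} (hk : ∀ a, (f a).length = k)
    (l : List α) (i : ℕ) {j : ℕ} (hj : j < k) :
    (l.flatMap f)[i * k + j]? = l[i]?.bind fun a => (f a)[j]? := by
  induction l generalizing i with
  | nil => simp
  | cons a l ih =>
    rw [List.flatMap_cons]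
    rcases i with _ | i
    · simp [List.getElem?_append_left (show j < (f a).length by rw [hk]; exact hj)]
    · rw [show (i + 1) * k + j = k + (i * k + j) by ring, getElem?_append_add (hk a), ih]
      simp

theorem getElem?_flatMap_finRange {β : Type*} {n k : ℕ} {f : Fin n → List β}
    (hk : ∀ a, (f a).length = k) (i : Fin n) {j : ℕ} (hj : j < k) :
    ((List.finRange n).flatMap f)[(i : ℕ) * k + j]? = (f i)[j]? := by
  rw [getElem?_flatMap hk _ _ hj]
  simp

theorem length_flatMap_finRange {β : Type*} {n k : ℕ} {f : Fin n → List β}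
    (hk : ∀ a, (f a).length = k) : ((List.finRange n).flatMap f).length = n * k := by
  simp [List.length_flatMap, hk]

theorem mul_add_lt {a b m n : ℕ} (ha : a < m) (hb : b < n) : a * n + b < m * n := by
  nlinarith

namespace Instance

variable (I : Instance)

/-- The first numbers of an instance. -/
def header : List ℕ := [I.nΨ, I.nSig, I.nΥ, I.nQ, I.nS, I.D.q₀, I.B.s₀, I.υ₀]

/-- The table of the output labelling. -/
def tableL : List ℕ :=
  (List.finRange I.nQ).flatMap fun q : Fin I.nQ => [(q : ℕ), (I.D.L q : ℕ)]

/-- The table of the transition function of the transducer. -/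
def tableη : List ℕ :=
  (List.finRange I.nQ).flatMap fun q : Fin I.nQ => (List.finRange I.nΨ).flatMap fun ψ : Fin I.nΨ =>
    [(q : ℕ), (ψ : ℕ), optCode (I.D.η q ψ)]

/-- The table of the set of Büchi states. -/
def tableF : List ℕ :=
  (List.finRange I.nS).flatMap fun s : Fin I.nS => [(s : ℕ), if s ∈ I.B.F then 1 else 0]

/-- The table of the transition function of the automaton. -/
def tableδ : List ℕ :=
  (List.finRange I.nS).flatMap fun s : Fin I.nS => (List.finRange I.nΥ).flatMap fun υ : Fin I.nΥ =>
    (List.finRange I.nSig).flatMap fun σ : Fin I.nSig =>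
      [(s : ℕ), (υ : ℕ), (σ : ℕ), optCode (I.B.δ s (υ, σ))]

theorem toNats_append (l : List ℕ) : I.toNats ++ l =
    I.header ++ (I.tableL ++ (I.tableη ++ (I.tableF ++ (I.tableδ ++ l)))) := by
  have : I.toNats = I.header ++ (I.tableL ++ (I.tableη ++ (I.tableF ++ I.tableδ))) := rfl
  simp only [this, List.append_assoc]

theorem length_header : I.header.length = 8 := rfl

theorem length_tableL : I.tableL.length = I.nQ * 2 := length_flatMap_finRange fun _ => rfl

theorem length_tableη : I.tableη.length = I.nQ * (I.nΨ * 3) :=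
  length_flatMap_finRange fun _ => length_flatMap_finRange fun _ => rfl

theorem length_tableF : I.tableF.length = I.nS * 2 := length_flatMap_finRange fun _ => rfl

theorem length_tableδ : I.tableδ.length = I.nS * (I.nΥ * (I.nSig * 4)) :=
  length_flatMap_finRange fun _ => length_flatMap_finRange fun _ =>
    length_flatMap_finRange fun _ => rfl

theorem readSeq_header {i v : ℕ} (h : I.header[i]? = some v) (A : List Bool) :
    Term.readSeq (natsToBits I.toNats ++ A) i = v := by
  refine readSeq_of_getElem? ?_ A
  rw [← List.append_nil I.toNats, toNats_append]
  exact getElem?_append_of_some h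

/-- The instance is a prefix and its header fixes all offsets, so no certificate `A` can alter what
is read as the instance. -/
theorem represents (A : List Bool) :
    (Tables.ofSeq (Term.readSeq (natsToBits I.toNats ++ A))).Represents I := by
  have h0 := I.readSeq_header (i := 0) rfl A
  have h1 := I.readSeq_header (i := 1) rfl A
  have h2 := I.readSeq_header (i := 2) rfl A
  have h3 := I.readSeq_header (i := 3) rfl A
  have h4 := I.readSeq_header (i := 4) rfl A
  refine ⟨h0, h1, h2, h3, h4, I.readSeq_header rfl A, I.readSeq_header rfl A,
    I.readSeq_header rfl A, fun q => ?_, fun q ψ => ?_, fun s => ?_, fun s υ σ => ?_⟩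
  all_goals
    simp only [Tables.ofSeq, h0, h1, h2, h3, h4]
    refine readSeq_of_getElem? ?_ A
    rw [← List.append_nil I.toNats, toNats_append, getElem?_append_add I.length_header]
  · refine getElem?_append_of_some ?_
    exact getElem?_flatMap_finRange (k := 2) (j := 1) (fun _ => rfl) q (by omega)
  · rw [getElem?_append_add I.length_tableL]
    refine getElem?_append_of_some ?_
    have h1 : ψ * 3 + 2 < I.nΨ * 3 := mul_add_lt ψ.2 (by omega)
    rw [tableη, getElem?_flatMap_finRange
      (fun _ => length_flatMap_finRange (k := 3) fun _ => rfl) q h1,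
      getElem?_flatMap_finRange (k := 3) (j := 2) (fun _ => rfl) ψ (by omega)]
    rfl
  · rw [getElem?_append_add I.length_tableL, getElem?_append_add I.length_tableη]
    refine getElem?_append_of_some ?_
    exact getElem?_flatMap_finRange (k := 2) (j := 1) (fun _ => rfl) s (by omega)
  · rw [getElem?_append_add I.length_tableL, getElem?_append_add I.length_tableη,
      getElem?_append_add I.length_tableF]
    refine getElem?_append_of_some ?_
    have h1 : σ * 4 + 3 < I.nSig * 4 := mul_add_lt σ.2 (by omega)
    have h2 : υ * (I.nSig * 4) + (σ * 4 + 3) < I.nΥ * (I.nSig * 4) := mul_add_lt υ.2 h1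
    rw [tableδ, getElem?_flatMap_finRange (fun _ => length_flatMap_finRange fun _ =>
      length_flatMap_finRange (k := 4) fun _ => rfl) s h2,
      getElem?_flatMap_finRange (fun _ => length_flatMap_finRange (k := 4) fun _ => rfl) υ h1,
      getElem?_flatMap_finRange (k := 4) (j := 3) (fun _ => rfl) σ (by omega)]
    rfl

variable {I}

/-! ### Certificates and their length -/

section

variable (c : Fin I.nQ → Fin I.nS → ℕ) (T : Fin I.nQ → Fin I.nS → Fin I.nΨ → Fin I.nΥ → ℕ)
  (e : Option (Fin I.nQ) → Fin I.nS → ℕ)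

/-- The table of the classes of the pairs. -/
def tableC : List ℕ :=
  (List.finRange I.nQ).flatMap fun q => (List.finRange I.nS).map fun s => c q s

/-- The table of the classes of the transitions. -/
def tableT : List ℕ :=
  (List.finRange I.nQ).flatMap fun q => (List.finRange I.nS).flatMap fun s =>
    (List.finRange I.nΨ).flatMap fun ψ => (List.finRange I.nΥ).map fun υ => T q s ψ υ

/-- The table of the codes of the ranks. -/
def tableD : List ℕ :=
  ((List.finRange I.nQ).flatMap fun q => (List.finRange I.nS).map fun s => e (some q) s) ++
    (List.finRange I.nS).map fun s => e none s

/-- A class ranking, written out as a sequence of numbers. -/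
def certificate : List ℕ := tableC c ++ (tableT T ++ tableD e)

theorem length_tableC : (tableC c).length = I.nQ * I.nS :=
  length_flatMap_finRange fun _ => by simp

theorem length_tableT : (tableT T).length = I.nQ * (I.nS * (I.nΨ * I.nΥ)) :=
  length_flatMap_finRange fun _ => length_flatMap_finRange fun _ =>
    length_flatMap_finRange fun _ => by simp

theorem length_tableD : (tableD e).length = I.nQ * I.nS + I.nS := by
  rw [tableD, List.length_append, length_flatMap_finRange (k := I.nS) (fun _ => by simp)]
  simp

theorem readSeq_certificate {i v : ℕ} (h : (certificate c T e)[i]? = some v) :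
    Term.readSeq (natsToBits I.toNats ++ natsToBits (certificate c T e))
      (8 + (I.nQ * 2 + (I.nQ * (I.nΨ * 3) + (I.nS * 2 + (I.nS * (I.nΥ * (I.nSig * 4)) + i))))) =
      v := by
  rw [← natsToBits_append, ← List.append_nil (natsToBits _)]
  refine readSeq_of_getElem? ?_ []
  rw [toNats_append, getElem?_append_add I.length_header, getElem?_append_add I.length_tableL,
    getElem?_append_add I.length_tableη, getElem?_append_add I.length_tableF,
    getElem?_append_add I.length_tableδ, h]

theorem ofSeq_certificate :
    let t := Tables.ofSeq
      (Term.readSeq (natsToBits I.toNats ++ natsToBits (certificate c T e)))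
    (∀ q s, t.c (q : Fin I.nQ) (s : Fin I.nS) = c q s) ∧
      (∀ q s ψ υ, t.T (q : Fin I.nQ) (s : Fin I.nS) (ψ : Fin I.nΨ) (υ : Fin I.nΥ) = T q s ψ υ) ∧
      ∀ x s, t.d (Tables.row x) (s : Fin I.nS) = e x s := by
  have h0 := I.readSeq_header (i := 0) rfl (natsToBits (certificate c T e))
  have h1 := I.readSeq_header (i := 1) rfl (natsToBits (certificate c T e))
  have h2 := I.readSeq_header (i := 2) rfl (natsToBits (certificate c T e))
  have h3 := I.readSeq_header (i := 3) rfl (natsToBits (certificate c T e))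
  have h4 := I.readSeq_header (i := 4) rfl (natsToBits (certificate c T e))
  refine ⟨fun q s => ?_, fun q s ψ υ => ?_, fun x s => ?_⟩
  all_goals
    simp only [Tables.ofSeq, h0, h1, h2, h3, h4]
    refine readSeq_certificate c T e ?_
  · refine getElem?_append_of_some ?_
    rw [tableC, getElem?_flatMap_finRange (fun _ => by simp) q s.2]
    simp
  · rw [certificate, getElem?_append_add (length_tableC c)]
    refine getElem?_append_of_some ?_
    have h3 := mul_add_lt ψ.2 υ.2
    have h2 := mul_add_lt s.2 h3
    rw [tableT, getElem?_flatMap_finRange (fun _ => length_flatMap_finRange fun _ =>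
      length_flatMap_finRange fun _ => by simp) q h2,
      getElem?_flatMap_finRange (fun _ => length_flatMap_finRange fun _ => by simp) s h3,
      getElem?_flatMap_finRange (fun _ => by simp) ψ υ.2]
    simp
  · rw [certificate, getElem?_append_add (length_tableC c), getElem?_append_add (length_tableT T),
      tableD]
    rcases x with _ | q
    · rw [Tables.row, Option.elim_none,
        getElem?_append_add (length_flatMap_finRange fun _ => by simp)]
      simp
    · refine getElem?_append_of_some ?_
      rw [Tables.row, Option.elim_some, getElem?_flatMap_finRange (fun _ => by simp) q s.2]
      simp

theorem length_certificate_le {M : ℕ} (hc : ∀ q s, c q s ≤ M) (hT : ∀ q s ψ υ, T q s ψ υ ≤ M)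
    (he : ∀ x s, e x s ≤ M) : (natsToBits (certificate c T e)).length ≤
      (I.nQ * I.nS + (I.nQ * (I.nS * (I.nΨ * I.nΥ)) + (I.nQ * I.nS + I.nS))) * (M + 1) := by
  refine (length_natsToBits_le (M := M) fun n hn => ?_).trans (le_of_eq ?_)
  · simp only [certificate, tableC, tableT, tableD, List.mem_append, List.mem_flatMap, List.mem_map,
      List.mem_finRange, true_and] at hn
    rcases hn with ⟨q, s, rfl⟩ | ⟨q, s, ψ, υ, rfl⟩ | ⟨q, s, rfl⟩ | ⟨s, rfl⟩
    exacts [hc _ _, hT _ _ _ _, he _ _, he _ _]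
  · rw [certificate, List.length_append, List.length_append, length_tableC, length_tableT,
      length_tableD]

end

/-- A polynomial bound for the length of certificates. -/
noncomputable def certificateBound : Polynomial ℕ :=
  (.X * .X + (.X * (.X * (.X * .X)) + (.X * .X + .X))) *
    (.X * (.X * (.X * .X)) + 1 + ((.X + 1) * .X + 1) + 1)

/-- Completeness writes out a small class ranking; soundness reads one off any accepted word. -/
theorem hasWeightRanking_iff (I : Instance) : I.HasWeightRanking ↔
    ∃ c : List Bool, c.length ≤ certificateBound.eval (instanceEncoding.encode I).length ∧
      Term.validTerm.eval (instanceEncoding.encode I ++ c) (fun _ => 0) ≠ 0 := by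
  have henc : instanceEncoding.encode I = natsToBits I.toNats := rfl
  have hvalid : ∀ A, Term.validTerm.eval (natsToBits I.toNats ++ A) (fun _ => 0) ≠ 0 ↔ _ :=
    fun A => Term.holds_validTerm.trans (I.represents A).valid_iff
  rw [henc]
  constructor
  · intro h
    obtain ⟨c, T, e, h, hc, hT, he⟩ := exists_isWeightRanking_iff.1 h
    simp only [Fintype.card_prod, Fintype.card_fin, Fintype.card_option] at hc hT he
    refine ⟨natsToBits (certificate c T e), ?_, (hvalid _).2 ?_⟩
    · refine (length_certificate_le c T e
        -- The sum of the bounds for classes and for rank codes bounds every entry.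
        (M := I.nQ * (I.nS * (I.nΨ * I.nΥ)) + 1 + ((I.nQ + 1) * I.nS + 1))
        (fun q s => (hc q s).trans (by omega)) (fun q s ψ υ => (hT q s ψ υ).trans (by omega))
        (fun x s => (he x s).trans (by omega))).trans ?_
      -- The sizes are written in unary in the instance, so its length bounds them.
      have hmem : ∀ n ∈ I.header, n ≤ (natsToBits I.toNats).length := fun n hn =>
        le_length_natsToBits (List.mem_append_left _ hn)
      have hΨ := hmem I.nΨ (by simp [header])
      have hΥ := hmem I.nΥ (by simp [header])
      have hQ := hmem I.nQ (by simp [header])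
      have hS := hmem I.nS (by simp [header])
      simp only [certificateBound, Polynomial.eval_add, Polynomial.eval_mul, Polynomial.eval_X,
        Polynomial.eval_one]
      gcongr
    · obtain ⟨h1, h2, h3⟩ := ofSeq_certificate c T e
      simpa only [h1, h2, h3] using h
  -- The word `A` need not be well formed: whatever numbers are read from it, with `0` past its end,
  -- they form a class ranking.
  · rintro ⟨A, -, h⟩
    exact ⟨_, _, _, ((hvalid A).1 h).isWeightRanking⟩

end Instance

end BuchiCover

theorem mainTheorem3 :
    (∀ {Ψ Sig Υ Q S : Type*} [Fintype Ψ] [Fintype Υ] [Fintype Q] [Fintype S]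
        (D : BuchiCover.Transducer Ψ Sig Q) (B : BuchiCover.DBW (Υ × Sig) S) (υ₀ : Υ)
        (w : Q → S → ℕ) (wt : Q → S → Ψ → Υ → ℕ) (d : Option Q → S → ℕ∞),
      BuchiCover.IsWeightRanking D B υ₀ w wt d →
        (∀ q s, BuchiCover.JointReachable D B υ₀ q s →
          w q s ≤ Fintype.card Υ ^ (Fintype.card Q * Fintype.card S) ∧
          ∀ ψ υ, wt q s ψ υ ≤ Fintype.card Υ ^ (Fintype.card Q * Fintype.card S)) ∧
        ∃ d' : Option Q → S → ℕ∞, BuchiCover.IsWeightRanking D B υ₀ w wt d' ∧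
          ∀ x s, d' x s ≠ ⊤ → d' x s ≤ ((Fintype.card (Option Q) * Fintype.card S : ℕ) : ℕ∞)) ∧
    BuchiCover.InNP BuchiCover.instanceEncoding BuchiCover.Instance.HasWeightRanking := by
  refine ⟨fun D B υ₀ w wt d h => ⟨fun q s hr => ?_, h.exists_bounded_rank⟩,
    BuchiCover.inNP_of_term _ _ _ _ BuchiCover.Instance.hasWeightRanking_iff⟩
  -- The direction `υ₀` shows that `Υ` is nonempty, so its powers are at least `1`.
  have hone : ∀ n, w q s ≤ Fintype.card _ ^ n := fun n =>
    (h.weight_le_one hr).trans (Nat.one_le_pow n _ (Fintype.card_pos_iff.2 ⟨υ₀⟩))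
  exact ⟨hone _, fun ψ υ => (h.wt_le q s ψ υ).trans (hone _)⟩
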